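/- Let $m>1$ be a square-free integer of the form $m=4t+2$ with $t\ge 0$. For a nonzero integer $a$ and a positive integer $s$ put $$L_a(s)=\sum_{l>0,\ l\text{ odd}}\left(\frac{-a}{l}\right)\frac1{l^{s}},$$ where $\left(\frac{\cdot}{\cdot}\right)$ is the Jacobi symbol and the terms are summed in increasing order of $l$. Define the generalized Euler and class numbers $s_{m,n}$ $(n\ge 0)$ by $$s_{m,2n}=\frac{(2n)!}{\sqrt m}\left(\frac{\pi}{2m}\right)^{-2n-1}L_m(2n+1)\quad(n\ge 0),\qquad s_{m,2n-1}=\frac{(2n-1)!}{\sqrt m}\left(\frac{\pi}{2m}\right)^{-2n}L_{-m}(2n)\quad(n\ge 1),$$ let $s_m(x)=\sum_{n\ge 0}s_{m,n}\frac{x^n}{n!}$, and for $0\le p\le m$ let $$\Lambda_{m,p}(x)=\frac{\cos((m-p)x)+\sin(px)}{\cos(mx)}.$$ Then the series $L_m(2n+1)$ $(n\ge 0)$ and $L_{-m}(2n)$ $(n\ge 1)$ converge, and for every complex $x$ with $|x|<\frac{\pi}{2m}$ the series $s_m(x)$ converges absolutely and $$s_m(x)=\sum_{\substack{k=1\\ k\text{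 odd}}}^{4t+1}\left(\frac{-m}{k}\right)\Lambda_{m,k}(x).$$ -/

import Mathlib

open Filter Topology
open scoped Nat NumberTheorySymbols

namespace ShanksNumbers

noncomputable section

/-- The partial sum of the first `N` terms (odd `l = 1, 3, …, 2N - 1`, in increasing order) of the
Dirichlet series `L_m(s) = ∑_{l > 0, l odd} (-m / l) / l ^ s`, with `(-m / l)` the Jacobi symbol.
The index `m` may be negative; `s` is a natural number. -/
def dirichletPartialSum (m : ℤ) (s : ℕ) (N : ℕ) : ℝ :=
  ∑ j ∈ Finset.range N, (J(-m | 2 * j + 1) : ℝ) / ((2 * j + 1 : ℕ) : ℝ) ^ s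

/-- The value `L_m(s)` of the Dirichlet series: the limit of its partial sums. A limit of partial
sums is used, since the series `L_m(1)` converges only conditionally. -/
def dirichletL (m : ℤ) (s : ℕ) : ℝ :=
  limUnder atTop (dirichletPartialSum m s)

/-- The constant `K_m`: `1 / 2` if `m = 1` and `1` otherwise. -/
def K (m : ℕ) : ℝ := if m = 1 then 1 / 2 else 1

/-- `c_{m,n} = (2n)! L_m(2n+1) (K_m √m)⁻¹ (π / (2m)) ^ (-2n-1)`. -/
def c (m n : ℕ) : ℝ :=
  ((2 * n)! : ℝ) * dirichletL m (2 * n + 1) * (K m * √(m : ℝ))⁻¹ *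
    (Real.pi / (2 * m)) ^ (-2 * (n : ℤ) - 1)

/-- `d_{m,n} = (2n-1)! L_{-m}(2n) (K_m √m)⁻¹ (π / (2m)) ^ (-2n)`, for `n ≥ 1`. -/
def d (m n : ℕ) : ℝ :=
  ((2 * n - 1)! : ℝ) * dirichletL (-(m : ℤ)) (2 * n) * (K m * √(m : ℝ))⁻¹ *
    (Real.pi / (2 * m)) ^ (-2 * (n : ℤ))

/-- The generalized Euler and class numbers `s_{m,n}`: `c_{m,n/2}` for even `n` and
`d_{m,(n+1)/2}` for odd `n`. -/
def s (m n : ℕ) : ℝ :=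
  if Even n then c m (n / 2) else d m ((n + 1) / 2)

/-- The `n`-th term of the exponential generating function of the numbers `s_{m,n}`. -/
def sTerm (m : ℕ) (x : ℂ) (n : ℕ) : ℂ :=
  (s m n : ℂ) * (x ^ n / (n ! : ℂ))

/-- The generating function `s_m(x) = ∑_{n ≥ 0} s_{m,n} x ^ n / n!`. -/
def sGen (m : ℕ) (x : ℂ) : ℂ := ∑' n : ℕ, sTerm m x n

/-- `Λ_{m,p}(x) = (cos ((m-p) x) + sin (p x)) / cos (m x)`. -/
def Lam (m p : ℕ) (x : ℂ) : ℂ :=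
  (Complex.cos (((m : ℂ) - (p : ℂ)) * x) + Complex.sin ((p : ℂ) * x)) / Complex.cos ((m : ℂ) * x)

end

end ShanksNumbers

/-! Write m = 2q with q odd and squarefree, and let K be the Kronecker symbol (-2q/·), of modulus 8q
= 4m. Two finite Fourier expansions carry the arithmetic. For odd l, the Gauss sum of K and the
symmetries of K give K(l) = (2/√m) ∑ K(k) sin(k l π/(2m)) over odd k < m (`kronecker_eq_sum_sin`).
Multiplying by χ₄(l) = sin(lπ/2) gives (m/l) = (2/√m) ∑ K(k) cos((m-k) l π/(2m))
(`jacobiSym_eq_sum_cos`).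

For the analysis put a_j = (2j+1)π/(2m). Geometric series turn the odd part of s_m(x) into (x/√m) ∑
(m/(2j+1)) / (a_j² - x²), and the even part without its constant term into (x²/√m) ∑ K(2j+1) / (a_j
(a_j² - x²)). After inserting the finite expansions, the inner sums over j are the partial fractions
of sin((m-y)x)/cos(mx) and cos((m-y)x)/cos(mx) - 1 (`hasSum_cos_div_sq_sub`,
`hasSum_sin_div_sq_sub`); these are Fourier series in y of functions antiperiodic with respect to
2m. The constant term needs the conditionally convergent L_m(1), which the square wave series
(`tendsto_sum_sin_odd`) evaluates; its value ∑ K(k) cancels the -1 above.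

The expansions require the Gauss sum with its sign. Modulo a prime the sign comes from Gauss's
product for the alternating sum of q-binomials at a root of unity (`gaussSum_quadraticCharC`); the
Chinese remainder theorem and quadratic reciprocity extend it to q (`jacobiGauss_eq`) and then to 8q
(`sum_kronecker_mul_exp`). -/

namespace ShanksNumbers

/-! ### Gaussian binomials and the sum of w^(j(j+1)/2) at a root of unity. -/

/-- The Gaussian binomial coefficient `[i + j choose j]_q`, defined by the `q`-Pascal rule. -/
def gaussBinom (q : ℂ) : ℕ → ℕ → ℂ
  | _, 0 => 1
  | 0, _ + 1 => 1
  | i + 1, j + 1 => gaussBinom q (i + 1) j + q ^ (j + 1) * gaussBinom q i (j + 1)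
termination_by i j => i + j

lemma gaussBinom_zero_right (q : ℂ) (i : ℕ) : gaussBinom q i 0 = 1 := by
  cases i <;> simp [gaussBinom]

lemma gaussBinom_zero_left (q : ℂ) (j : ℕ) : gaussBinom q 0 j = 1 := by
  cases j <;> simp [gaussBinom]

lemma gaussBinom_succ_succ (q : ℂ) (i j : ℕ) :
    gaussBinom q (i + 1) (j + 1) =
      gaussBinom q (i + 1) j + q ^ (j + 1) * gaussBinom q i (j + 1) := by
  rw [gaussBinom]

/-- Both sides equal (1 - q^(i+j+1)) [i+j choose j]. This is the product formula with denominators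
cleared, so it remains valid at roots of unity, where it is needed. -/
lemma gaussBinom_exchange (q : ℂ) : ∀ n i j : ℕ, i + j = n →
    (1 - q ^ (j + 1)) * gaussBinom q i (j + 1) = (1 - q ^ (i + 1)) * gaussBinom q (i + 1) j := by
  intro n
  induction n with
  | zero =>
    intro i j h
    obtain ⟨rfl, rfl⟩ : i = 0 ∧ j = 0 := by omega
    simp [gaussBinom_zero_left, gaussBinom_zero_right]
  | succ n ih =>
    intro i j h
    have hL : ∀ i j, i + j = n + 1 →
        (1 - q ^ (j + 1)) * gaussBinom q i (j + 1) = (1 - q ^ (i + j + 1)) * gaussBinom q i j := by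
      intro i j h
      cases i with
      | zero => simp [gaussBinom_zero_left]
      | succ i =>
        have := ih i j (by omega)
        rw [gaussBinom_succ_succ]
        linear_combination q ^ (j + 1) * this
    rw [hL i j h]
    cases j with
    | zero => simp [gaussBinom_zero_right]
    | succ j =>
      have := ih i j (by omega)
      rw [gaussBinom_succ_succ]
      linear_combination this

lemma gaussBinom_succ_left (q : ℂ) (i j : ℕ) :
    (1 - q ^ (i + 1)) * gaussBinom q (i + 1) j = (1 - q ^ (i + j + 1)) * gaussBinom q i j := by
  cases j with
  | zero => simp [gaussBinom_zero_right]
  | succ j =>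
    have := gaussBinom_exchange q _ i j rfl
    rw [gaussBinom_succ_succ]
    linear_combination -this

/-- The second q-Pascal rule, in which the power of q goes with the other summand; the exchange
identity is exactly the difference of the two rules. -/
lemma gaussBinom_succ_succ' (q : ℂ) (i j : ℕ) :
    gaussBinom q (i + 1) (j + 1) =
      gaussBinom q i (j + 1) + q ^ (i + 1) * gaussBinom q (i + 1) j := by
  have := gaussBinom_exchange q _ i j rfl
  rw [gaussBinom_succ_succ]
  linear_combination -this

/-- The alternating sum of the Gaussian binomial coefficients of order `n`. -/
def gaussAlt (q : ℂ) (n : ℕ) : ℂ :=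
  ∑ p ∈ Finset.HasAntidiagonal.antidiagonal n, (-1) ^ p.2 * gaussBinom q p.1 p.2

/-- The second q-Pascal rule, applied to every term except the two ends, splits the sum into two
sums of order n with opposite signs. -/
lemma gaussAlt_succ (q : ℂ) (n : ℕ) :
    gaussAlt q (n + 1) =
      ∑ p ∈ Finset.HasAntidiagonal.antidiagonal n, (-1) ^ p.2 * ((1 - q ^ p.1) * gaussBinom q p.1 p.2) := by
  cases n with
  | zero => simp [gaussAlt, Finset.Nat.antidiagonal_succ, gaussBinom_zero_left,
      gaussBinom_zero_right]
  | succ n =>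
    have h1 : gaussAlt q (n + 2) = (-1) ^ (n + 2) + 1 + ∑ p ∈ Finset.HasAntidiagonal.antidiagonal n,
        (-1) ^ (p.2 + 1) * gaussBinom q (p.1 + 1) (p.2 + 1) := by
      rw [gaussAlt, Finset.Nat.sum_antidiagonal_succ, Finset.Nat.sum_antidiagonal_succ']
      simp [gaussBinom_zero_left, gaussBinom_zero_right]
      ring
    have h2 : ∑ p ∈ Finset.HasAntidiagonal.antidiagonal (n + 1), (-1) ^ p.2 * gaussBinom q p.1 p.2 =
        1 + ∑ p ∈ Finset.HasAntidiagonal.antidiagonal n, (-1) ^ (p.2 + 1) * gaussBinom q p.1 (p.2 + 1) := by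
      rw [Finset.Nat.sum_antidiagonal_succ']
      simp [gaussBinom_zero_right]
    have h3 : ∑ p ∈ Finset.HasAntidiagonal.antidiagonal (n + 1), (-1) ^ p.2 * (q ^ p.1 * gaussBinom q p.1 p.2) =
        (-1) ^ (n + 1) + ∑ p ∈ Finset.HasAntidiagonal.antidiagonal n,
          (-1) ^ p.2 * (q ^ (p.1 + 1) * gaussBinom q (p.1 + 1) p.2) := by
      rw [Finset.Nat.sum_antidiagonal_succ]
      simp [gaussBinom_zero_left]
    simp only [sub_mul, one_mul, mul_sub, Finset.sum_sub_distrib]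
    rw [h1, h2, h3]
    have h4 : ∑ p ∈ Finset.HasAntidiagonal.antidiagonal n,
        (-1 : ℂ) ^ (p.2 + 1) * gaussBinom q (p.1 + 1) (p.2 + 1) =
        ∑ p ∈ Finset.HasAntidiagonal.antidiagonal n, (-1) ^ (p.2 + 1) * gaussBinom q p.1 (p.2 + 1) -
        ∑ p ∈ Finset.HasAntidiagonal.antidiagonal n,
          (-1) ^ p.2 * (q ^ (p.1 + 1) * gaussBinom q (p.1 + 1) p.2) := by
      rw [← Finset.sum_sub_distrib]
      refine Finset.sum_congr rfl fun p _ => ?_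
      rw [gaussBinom_succ_succ']
      ring
    rw [h4]
    ring

lemma gaussAlt_add_two (q : ℂ) (n : ℕ) :
    gaussAlt q (n + 2) = (1 - q ^ (n + 1)) * gaussAlt q n := by
  rw [gaussAlt_succ, Finset.Nat.sum_antidiagonal_succ, gaussAlt, Finset.mul_sum]
  simp only [pow_zero, sub_self, zero_mul, mul_zero, zero_add]
  refine Finset.sum_congr rfl fun p hp => ?_
  rw [Finset.HasAntidiagonal.mem_antidiagonal] at hp
  rw [gaussBinom_succ_left, hp]
  ring

/-- Gauss's evaluation of the alternating sum of Gaussian binomial coefficients. -/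
lemma gaussAlt_two_mul (q : ℂ) (M : ℕ) :
    gaussAlt q (2 * M) = ∏ j ∈ Finset.range M, (1 - q ^ (2 * j + 1)) := by
  induction M with
  | zero => simp [gaussAlt, gaussBinom_zero_left]
  | succ M ih =>
    rw [show 2 * (M + 1) = 2 * M + 2 by ring, gaussAlt_add_two, ih, Finset.prod_range_succ, mul_comm]

/-- Since w^(-(i+1)) = w^(j+1) when i + j + 2 = N, the ratio of consecutive coefficients in row N -
1 is (1 - w^(j+1)) / (1 - w^(-(j+1))) = -w^(j+1); the exponents 1, ..., j add up to a triangular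
number. -/
lemma pow_mul_gaussBinom_of_primitive {w : ℂ} {N : ℕ} (hw : IsPrimitiveRoot w N) (j : ℕ) :
    ∀ i, i + j + 1 = N → (-1) ^ j * gaussBinom w⁻¹ i j = w ^ (j * (j + 1) / 2) := by
  induction j with
  | zero => simp [gaussBinom_zero_right]
  | succ j ih =>
    intro i hij
    have h0 : w ≠ 0 := hw.ne_zero (by omega)
    have hex := gaussBinom_exchange w⁻¹ _ i j rfl
    have hN : w⁻¹ ^ (i + 1) = w ^ (j + 1) := by
      rw [inv_pow]
      refine inv_eq_of_mul_eq_one_right ?_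
      rw [← pow_add, show i + 1 + (j + 1) = N by omega, hw.pow_eq_one]
    have hne : w ^ (j + 1) ≠ 1 := hw.pow_ne_one_of_pos_of_lt (by omega) (by omega)
    have hih := ih (i + 1) (by omega)
    have hex' : gaussBinom w⁻¹ i (j + 1) = -w ^ (j + 1) * gaussBinom w⁻¹ (i + 1) j := by
      rw [hN, inv_pow] at hex
      have h1 : w ^ (j + 1) - 1 ≠ 0 := sub_ne_zero.2 hne
      have h2 : w ^ (j + 1) ≠ 0 := pow_ne_zero _ h0
      apply mul_left_cancel₀ h1
      have h3 : w ^ (j + 1) * (1 - (w ^ (j + 1))⁻¹) = w ^ (j + 1) - 1 := by field_simp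
      rw [← h3, mul_assoc, hex, h3]
      ring
    have hexp : (j + 1) * (j + 1 + 1) / 2 = j * (j + 1) / 2 + (j + 1) := by
      rw [show (j + 1) * (j + 1 + 1) = j * (j + 1) + (j + 1) * 2 by ring,
        Nat.add_mul_div_right _ _ two_pos]
    rw [hexp, pow_add w, ← hih, hex']
    ring

lemma sum_pow_triangular_of_primitive {w : ℂ} {M : ℕ} (hw : IsPrimitiveRoot w (2 * M + 1)) :
    ∑ j ∈ Finset.range (2 * M + 1), w ^ (j * (j + 1) / 2) =
      ∏ j ∈ Finset.range M, (1 - w⁻¹ ^ (2 * j + 1)) := by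
  rw [← gaussAlt_two_mul, gaussAlt, ← Finset.Nat.sum_antidiagonal_swap,
    Finset.Nat.sum_antidiagonal_eq_sum_range_succ_mk]
  refine Finset.sum_congr rfl fun j hj => ?_
  rw [Finset.mem_range] at hj
  exact (pow_mul_gaussBinom_of_primitive hw j _ (by simp; omega)).symm

lemma one_sub_exp_neg_two_mul (θ : ℂ) :
    1 - Complex.exp (-(2 * θ * Complex.I)) =
      Complex.exp (-(θ * Complex.I)) * (Complex.I * (2 * Complex.sin θ)) := by
  have h1 : Complex.exp (-(2 * θ * Complex.I)) =
      Complex.exp (-(θ * Complex.I)) * Complex.exp (-(θ * Complex.I)) := by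
    rw [← Complex.exp_add]; ring_nf
  have h2 : Complex.exp (-(θ * Complex.I)) * Complex.exp (θ * Complex.I) = 1 := by
    rw [← Complex.exp_add]; simp
  rw [h1, Complex.sin, neg_mul]
  linear_combination (-(Complex.exp (-(θ * Complex.I)) ^ 2 -
    Complex.exp (-(θ * Complex.I)) * Complex.exp (θ * Complex.I))) * Complex.I_sq - h2

/-- With w = exp(2iθ) and θ = π/(2M+1), each factor of Gauss's product is a phase times i times 2
sin((2j+1)θ), and these sines are positive. The power of w is split off because completing the
square produces the same power, so the two cancel. -/
lemma exists_pos_sum_pow_triangular (M : ℕ) :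
    ∃ P : ℝ, 0 < P ∧ ∑ j ∈ Finset.range (2 * M + 1),
        Complex.exp (2 * Real.pi * Complex.I / (2 * M + 1 : ℕ)) ^ (j * (j + 1) / 2) =
      Complex.exp (2 * Real.pi * Complex.I / (2 * M + 1 : ℕ)) ^ (M * (M + 1) / 2) *
        ((-Complex.I) ^ M * P) := by
  set θ : ℝ := Real.pi / (2 * M + 1 : ℕ) with hθ
  have hN : (0 : ℝ) < (2 * M + 1 : ℕ) := by positivity
  have hθM : (θ : ℂ) * (2 * M + 1) = Real.pi := by
    have : θ * (2 * M + 1 : ℕ) = Real.pi := by rw [hθ]; field_simp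
    exact_mod_cast congrArg (Complex.ofReal) this
  have hw : Complex.exp (2 * Real.pi * Complex.I / (2 * M + 1 : ℕ)) =
      Complex.exp (2 * θ * Complex.I) := by
    congr 1
    rw [hθ]
    push_cast
    ring
  refine ⟨∏ j ∈ Finset.range M, 2 * Real.sin (θ * (2 * j + 1)), ?_, ?_⟩
  · refine Finset.prod_pos fun j hj => ?_
    rw [Finset.mem_range] at hj
    have hj' : (j : ℝ) + 1 ≤ M := by exact_mod_cast hj
    have hθ0 : 0 < θ := by positivity
    have : 0 < Real.sin (θ * (2 * j + 1)) := by
      refine Real.sin_pos_of_pos_of_lt_pi (by positivity) ?_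
      rw [hθ, div_mul_eq_mul_div, div_lt_iff₀ hN]
      push_cast
      have := Real.pi_pos
      nlinarith
    positivity
  · rw [sum_pow_triangular_of_primitive
      (Complex.isPrimitiveRoot_exp (2 * M + 1) (by omega)), hw]
    have hfac : ∀ j ∈ Finset.range M, 1 - (Complex.exp (2 * θ * Complex.I))⁻¹ ^ (2 * j + 1) =
        Complex.exp (-(θ * (2 * j + 1) * Complex.I)) *
          (Complex.I * ((2 * Real.sin (θ * (2 * j + 1)) : ℝ) : ℂ)) := by
      intro j _
      rw [← Complex.exp_neg, ← Complex.exp_nat_mul]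
      have := one_sub_exp_neg_two_mul ((θ : ℂ) * (2 * j + 1))
      push_cast
      rw [← this]
      congr 2
      ring
    rw [Finset.prod_congr rfl hfac, Finset.prod_mul_distrib, Finset.prod_mul_distrib,
      Finset.prod_const, Finset.card_range, ← Complex.exp_sum, Complex.ofReal_prod]
    have hsum : ∑ j ∈ Finset.range M, -((θ : ℂ) * (2 * j + 1) * Complex.I) =
        -(θ * M ^ 2 * Complex.I) := by
      induction M with
      | zero => simp
      | succ n ih =>
        clear ih
        rw [Finset.sum_neg_distrib, ← Finset.sum_mul, ← Finset.mul_sum]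
        congr 3
        induction (n + 1) with
        | zero => simp
        | succ k ih => rw [Finset.sum_range_succ, ih]; push_cast; ring
    have htri : ((M * (M + 1) / 2 : ℕ) : ℂ) = M * (M + 1) / 2 := by
      rw [Nat.cast_div (Nat.even_mul_succ_self M).two_dvd (by norm_num)]
      push_cast
      ring
    rw [hsum, ← Complex.exp_nat_mul, htri, ← mul_assoc, ← mul_assoc]
    congr 1
    -- The phases add up to -M²θ = M(M+1)θ - Mπ because (2M+1)θ = π; the term -Mπ turns i^M into
    -- (-i)^M.
    have h1 : -((θ : ℂ) * M ^ 2 * Complex.I) =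
        M * (M + 1) / 2 * (2 * θ * Complex.I) + (M * (-(Real.pi * Complex.I))) := by
      rw [← hθM]
      ring
    rw [h1, Complex.exp_add, Complex.exp_nat_mul, Complex.exp_neg, Complex.exp_pi_mul_I, mul_assoc,
      ← mul_pow]
    norm_num

/-! ### The quadratic Gauss sum modulo an odd prime, with its sign. -/

/-- The sign of the quadratic Gauss sum modulo an odd number. -/
noncomputable def gaussSign (N : ℕ) : ℂ := if N % 4 = 1 then 1 else Complex.I

lemma stdAddChar_natCast {N : ℕ} [NeZero N] (n : ℕ) :
    ZMod.stdAddChar (n : ZMod N) = Complex.exp (2 * Real.pi * Complex.I / N) ^ n := by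
  have := ZMod.stdAddChar_coe (N := N) n
  rw [← Complex.exp_nat_mul]
  push_cast at this
  rw [this]
  congr 1
  ring

lemma sum_zmod_eq_sum_range {N : ℕ} [NeZero N] (f : ZMod N → ℂ) :
    ∑ x, f x = ∑ k ∈ Finset.range N, f k := by
  refine Finset.sum_nbij' (fun x => x.val) (fun k => (k : ZMod N)) ?_ ?_ ?_ ?_ ?_
  · intro x _; simpa using ZMod.val_lt x
  · simp
  · intro x _; simp
  · intro k hk; exact ZMod.val_cast_of_lt (Finset.mem_range.1 hk)
  · intro x _; simp

/-- The quadratic character modulo `p` with complex values. -/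
noncomputable def quadraticCharC (p : ℕ) [Fact p.Prime] : MulChar (ZMod p) ℂ :=
  (quadraticChar (ZMod p)).ringHomComp (Int.castRingHom ℂ)

lemma quadraticCharC_intCast (p : ℕ) [Fact p.Prime] (a : ℤ) :
    quadraticCharC p (a : ZMod p) = (J(a | p) : ℂ) := by
  rw [← jacobiSym.legendreSym.to_jacobiSym, legendreSym]
  rfl

/-- An element x has χ(x) + 1 square roots, so the sum over squares is the twisted Gauss sum plus a
full character sum, which vanishes. -/
lemma sum_stdAddChar_mul_sq {p : ℕ} [Fact p.Prime] (hp : p ≠ 2) (c : (ZMod p)ˣ) :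
    quadraticCharC p c * ∑ y : ZMod p, ZMod.stdAddChar ((c : ZMod p) * y ^ 2) =
      gaussSum (quadraticCharC p) ZMod.stdAddChar := by
  have hchar : ringChar (ZMod p) ≠ 2 := by rwa [ZMod.ringChar_zmod_n]
  rw [← gaussSum_mulShift _ _ c]
  congr 1
  have h1 : ∑ y : ZMod p, ZMod.stdAddChar ((c : ZMod p) * y ^ 2) =
      ∑ x : ZMod p, (quadraticCharC p x + 1) * ZMod.stdAddChar ((c : ZMod p) * x) := by
    rw [← Finset.sum_fiberwise Finset.univ (fun y : ZMod p => y ^ 2)]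
    refine Finset.sum_congr rfl fun x _ => ?_
    have h2 := quadraticChar_card_sqrts hchar x
    have h3 : (quadraticCharC p x + 1 : ℂ) =
        ((Finset.univ.filter fun y : ZMod p => y ^ 2 = x).card : ℂ) := by
      have : ((quadraticChar (ZMod p) x + 1 : ℤ) : ℂ) = quadraticCharC p x + 1 := by
        push_cast; rfl
      rw [← this, ← h2]
      simp
    rw [h3, ← nsmul_eq_mul, ← Finset.sum_const]
    refine Finset.sum_congr rfl fun y hy => ?_
    rw [(Finset.mem_filter.1 hy).2]
  rw [h1]
  simp only [add_mul, one_mul, Finset.sum_add_distrib]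
  have h4 : ∑ x : ZMod p, ZMod.stdAddChar ((c : ZMod p) * x) = 0 := by
    have := AddChar.sum_mulShift (R := ZMod p) (c : ZMod p) (ZMod.isPrimitive_stdAddChar p)
    simp only [c.ne_zero, if_false] at this
    simpa [mul_comm] using this
  rw [h4, add_zero]
  rfl

/-- Modulo p the inverse of 2 is M + 1 and -1/2 is M, so the shift j = y + M completes the square in
j(j+1)/2. -/
lemma sum_pow_triangular_prime {p M : ℕ} [Fact p.Prime] (hpM : p = 2 * M + 1) :
    ∃ c : (ZMod p)ˣ, (2 * c : ZMod p) = 1 ∧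
      ∑ j ∈ Finset.range p, Complex.exp (2 * Real.pi * Complex.I / p) ^ (j * (j + 1) / 2) =
      Complex.exp (2 * Real.pi * Complex.I / p) ^ (M * (M + 1) / 2) *
        ∑ y : ZMod p, ZMod.stdAddChar ((c : ZMod p) * y ^ 2) := by
  have hM : (2 * M + 1 : ZMod p) = 0 := by
    have : ((2 * M + 1 : ℕ) : ZMod p) = 0 := by rw [← hpM]; simp
    exact_mod_cast this
  have hc2 : (2 * (M + 1) : ZMod p) = 1 := by linear_combination hM
  let c : (ZMod p)ˣ := ⟨M + 1, 2, by linear_combination hM, hc2⟩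
  have hc : (c : ZMod p) = M + 1 := rfl
  have htri : ∀ j : ℕ, ((j * (j + 1) / 2 : ℕ) : ZMod p) = (M + 1) * (j * (j + 1)) := by
    intro j
    have : (2 : ZMod p) * ((j * (j + 1) / 2 : ℕ) : ZMod p) = j * (j + 1) := by
      exact_mod_cast congrArg (Nat.cast (R := ZMod p))
        (Nat.mul_div_cancel' (Nat.even_mul_succ_self j).two_dvd)
    rw [← this]
    linear_combination -((j * (j + 1) / 2 : ℕ) : ZMod p) * hM
  refine ⟨c, hc2, ?_⟩
  simp only [← stdAddChar_natCast, htri]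
  rw [← sum_zmod_eq_sum_range fun x : ZMod p => ZMod.stdAddChar ((M + 1 : ZMod p) * (x * (x + 1))),
    ← Equiv.sum_comp (Equiv.addRight (M : ZMod p)), Finset.mul_sum]
  refine Finset.sum_congr rfl fun y _ => ?_
  rw [← AddChar.map_add_eq_mul, hc]
  congr 1
  simp only [Equiv.coe_addRight]
  linear_combination (M + 1 : ZMod p) * y * hM

/-- The value of the quadratic Gauss sum modulo an odd prime, including its sign. -/
lemma gaussSum_quadraticCharC {p : ℕ} [Fact p.Prime] (hp : p ≠ 2) :
    gaussSum (quadraticCharC p) ZMod.stdAddChar = gaussSign p * (√(p : ℝ) : ℂ) := by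
  have hpp : p.Prime := Fact.out
  have hodd : Odd p := hpp.odd_of_ne_two hp
  have hchar : ringChar (ZMod p) ≠ 2 := by rwa [ZMod.ringChar_zmod_n]
  obtain ⟨M, hpM⟩ := hodd
  obtain ⟨c, hc, hsum⟩ := sum_pow_triangular_prime hpM
  obtain ⟨P, hP, hPsum⟩ := exists_pos_sum_pow_triangular M
  rw [← hpM, hsum] at hPsum
  have hA := mul_left_cancel₀ (pow_ne_zero _ (Complex.exp_ne_zero _)) hPsum
  have hG := sum_stdAddChar_mul_sq hp c
  rw [hA] at hG
  have hχ2 : quadraticCharC p c * quadraticCharC p 2 = 1 := by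
    rw [← map_mul, mul_comm, hc, map_one]
  have h2 : quadraticCharC p 2 = ((ZMod.χ₈ p : ℤ) : ℂ) := by
    have := quadraticCharC_intCast p 2
    rw [jacobiSym.at_two ⟨M, hpM⟩] at this
    exact_mod_cast this
  -- The known square χ(-1)p fixes the modulus P = √p; the phase is already determined by the
  -- positivity of P.
  have hsq := gaussSum_sq (χ := quadraticCharC p) (ψ := ZMod.stdAddChar)
    (by
      intro h
      refine quadraticChar_ne_one hchar ?_
      ext x
      have := DFunLike.congr_fun h (x : ZMod p)
      simp only [quadraticCharC, MulChar.ringHomComp_apply, MulChar.one_apply_coe] at this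
      simpa using this) ((quadraticChar_isQuadratic (ZMod p)).comp _)
    (ZMod.isPrimitive_stdAddChar p)
  have hm1 : quadraticCharC p (-1) = (-1) ^ M := by
    have := quadraticCharC_intCast p (-1)
    rw [jacobiSym.at_neg_one ⟨M, hpM⟩, ZMod.χ₄_eq_neg_one_pow (by omega),
      show p / 2 = M by omega] at this
    exact_mod_cast this
  rw [ZMod.card, hm1] at hsq
  have hχc2 : quadraticCharC p c ^ 2 = 1 := by
    have h := (quadraticChar_isQuadratic (ZMod p)).comp (Int.castRingHom ℂ) (c : ZMod p)
    have hne : quadraticCharC p (c : ZMod p) ≠ 0 := left_ne_zero_of_mul (hχ2 ▸ one_ne_zero)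
    rcases h with h | h | h
    · exact absurd h hne
    · simp only [quadraticCharC, h]; norm_num
    · simp only [quadraticCharC, h]; norm_num
  have hPp : P = √(p : ℝ) := by
    rw [← hG, mul_pow, hχc2, mul_pow, ← pow_mul, mul_comm M, pow_mul, neg_sq, Complex.I_sq,
      one_mul] at hsq
    have := mul_left_cancel₀ (pow_ne_zero _ (by norm_num)) hsq
    have h' : P ^ 2 = p := by exact_mod_cast this
    rw [← h', Real.sqrt_sq hP.le]
  have hχc : quadraticCharC p c = ((ZMod.χ₈ p : ℤ) : ℂ) := by
    rw [← h2]
    linear_combination quadraticCharC p 2 * hχc2 - quadraticCharC p c * hχ2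
  rw [← hG, hχc, ← hPp, ← mul_assoc]
  congr 1
  rw [ZMod.χ₈_nat_eq_if_mod_eight, gaussSign]
  -- M modulo 4 determines p modulo 8, hence both χ₈(p) = χ(2) = χ(c) and (-i)^M.
  obtain ⟨k, r, hMk, hr⟩ : ∃ k r, M = 4 * k + r ∧ r < 4 := ⟨M / 4, M % 4, by omega, by omega⟩
  have hI4 : (-Complex.I) ^ 4 = 1 := by rw [neg_pow, Complex.I_pow_four]; norm_num
  rw [hMk, pow_add, pow_mul, hI4, one_pow, one_mul]
  have hI3 : (-Complex.I) ^ 3 = Complex.I := by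
    rw [neg_pow, Complex.I_pow_three]; norm_num
  interval_cases r
  · rw [if_neg (by omega), if_pos (by omega), if_pos (by omega)]; simp
  · rw [if_neg (by omega), if_neg (by omega), if_neg (by omega)]; simp
  · rw [if_neg (by omega), if_neg (by omega), if_pos (by omega)]; simp
  · rw [if_neg (by omega), if_pos (by omega), if_neg (by omega), hI3]; simp

/-! ### Gauss sums of the Jacobi symbol modulo an odd squarefree number. -/

lemma sum_range_mul_of_coprime {A B : ℕ} (hA : 0 < A) (hB : 0 < B) (h : A.Coprime B) (f : ℕ → ℂ)
    (hf : ∀ n, f (n % (A * B)) = f n) :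
    ∑ k ∈ Finset.range (A * B), f k =
      ∑ u ∈ Finset.range A, ∑ v ∈ Finset.range B, f (B * u + A * v) := by
  rw [← Finset.sum_product']
  symm
  have hmaps : Set.MapsTo (fun x : ℕ × ℕ => (B * x.1 + A * x.2) % (A * B))
      (Finset.range A ×ˢ Finset.range B : Finset (ℕ × ℕ)) (Finset.range (A * B)) := by
    intro x _
    simpa using Nat.mod_lt _ (Nat.mul_pos hA hB)
  have hinj : Set.InjOn (fun x : ℕ × ℕ => (B * x.1 + A * x.2) % (A * B))
      (Finset.range A ×ˢ Finset.range B : Finset (ℕ × ℕ)) := by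
    rintro ⟨u, v⟩ hx ⟨u', v'⟩ hy hxy
    simp only [Finset.coe_product, Finset.coe_range, Set.mem_prod, Set.mem_Iio] at hx hy
    have hxy' : B * u + A * v ≡ B * u' + A * v' [MOD A * B] := hxy
    have h1 : B * u ≡ B * u' [MOD A] := by
      have := hxy'.of_mul_right B
      have e : ∀ u v, B * u + A * v ≡ B * u [MOD A] := fun u v => by
        simp [Nat.ModEq]
      exact (e u v).symm.trans (this.trans (e u' v'))
    have h2 : A * v ≡ A * v' [MOD B] := by
      have := hxy'.of_mul_left A
      have e : ∀ u v, B * u + A * v ≡ A * v [MOD B] := fun u v => by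
        simp [Nat.ModEq]
      exact (e u v).symm.trans (this.trans (e u' v'))
    have h1' := Nat.ModEq.cancel_left_of_coprime h h1
    have h2' := Nat.ModEq.cancel_left_of_coprime h.symm h2
    exact Prod.ext (h1'.eq_of_lt_of_lt hx.1 hy.1) (h2'.eq_of_lt_of_lt hx.2 hy.2)
  refine Finset.sum_nbij (fun x => (B * x.1 + A * x.2) % (A * B)) hmaps hinj ?_ ?_
  · exact Finset.surjOn_of_injOn_of_card_le _ hmaps hinj (by simp)
  · intro x _
    exact (hf _).symm

lemma exp_two_pi_mul_mod (a : ℤ) (n : ℕ) {N : ℕ} (hN : 0 < N) :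
    Complex.exp (2 * Real.pi * Complex.I * (a * (n % N : ℕ)) / N) =
      Complex.exp (2 * Real.pi * Complex.I * (a * n) / N) := by
  rw [Complex.exp_eq_exp_iff_exists_int]
  obtain ⟨d, hd⟩ : ∃ d : ℕ, n % N + N * d = n := ⟨n / N, Nat.mod_add_div n N⟩
  refine ⟨-(a * d), ?_⟩
  have h : (n : ℂ) = (n % N : ℕ) + N * d := by exact_mod_cast hd.symm
  have : (N : ℂ) ≠ 0 := by exact_mod_cast hN.ne'
  rw [h]
  push_cast
  field_simp
  ring

lemma jacobiSym_natCast_mod (n N : ℕ) : J((n % N : ℕ) | N) = J(n | N) := by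
  rw [jacobiSym.mod_left n N]
  norm_cast

/-- The quadratic Gauss sum with the Jacobi symbol modulo `N`. -/
noncomputable def jacobiGauss (N : ℕ) (a : ℤ) : ℂ :=
  ∑ k ∈ Finset.range N,
    (J(k | N) : ℂ) * Complex.exp (2 * Real.pi * Complex.I * (a * k) / N)

lemma jacobiGauss_prime {p : ℕ} (hp : p.Prime) (h2 : p ≠ 2) (a : ℤ) :
    jacobiGauss p a = J(a | p) * (gaussSign p * (√(p : ℝ) : ℂ)) := by
  have := Fact.mk hp
  have hsum : jacobiGauss p a =
      ∑ x : ZMod p, quadraticCharC p x * ZMod.stdAddChar ((a : ZMod p) * x) := by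
    rw [sum_zmod_eq_sum_range, jacobiGauss]
    refine Finset.sum_congr rfl fun k _ => ?_
    have h1 := quadraticCharC_intCast p k
    have h2 := ZMod.stdAddChar_coe (N := p) (a * k)
    push_cast at h1 h2
    rw [h1, h2]
  rw [hsum, ← gaussSum_quadraticCharC h2, ← quadraticCharC_intCast]
  have hchar : ringChar (ZMod p) ≠ 2 := by rwa [ZMod.ringChar_zmod_n]
  -- The twisting formula needs a unit; if p divides a, both sides vanish, the sum being that of a
  -- nontrivial character.
  by_cases ha : (a : ZMod p) = 0
  · have hne : quadraticCharC p ≠ 1 := by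
      intro h
      refine quadraticChar_ne_one hchar ?_
      ext x
      have := DFunLike.congr_fun h (x : ZMod p)
      simp only [quadraticCharC, MulChar.ringHomComp_apply, MulChar.one_apply_coe] at this
      simpa using this
    simp [ha, MulChar.sum_eq_zero_of_ne_one hne, MulChar.map_zero]
  · have hS := gaussSum_mulShift (quadraticCharC p) ZMod.stdAddChar (Units.mk0 _ ha)
    have hχ2 : quadraticCharC p a ^ 2 = 1 := by
      have := quadraticChar_sq_one (F := ZMod p) ha
      have := congrArg (Int.cast (R := ℂ)) this
      push_cast at this
      exact this
    rw [← hS, Units.val_mk0, ← mul_assoc, ← sq, hχ2, one_mul]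
    rfl

/-- The failure of multiplicativity is precisely the sign of quadratic reciprocity, so the two
cancel in `jacobiGauss_eq`. -/
lemma gaussSign_mul {M N : ℕ} (hM : Odd M) (hN : Odd N) :
    gaussSign (M * N) * (-1) ^ (M / 2 * (N / 2)) = gaussSign M * gaussSign N := by
  have key : ∀ n : ℕ, Odd n → n % 4 = 1 ∧ Even (n / 2) ∨ n % 4 = 3 ∧ Odd (n / 2) := by
    intro n hn
    rw [Nat.odd_iff] at hn
    rw [Nat.even_iff, Nat.odd_iff]
    omega
  rcases key M hM with ⟨h1, h1'⟩ | ⟨h1, h1'⟩ <;> rcases key N hN with ⟨h2, h2'⟩ | ⟨h2, h2'⟩ <;>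
    simp only [gaussSign, Nat.mul_mod M N, h1, h2]
  · rw [(h1'.mul_right _).neg_one_pow]; norm_num
  · rw [(h1'.mul_right _).neg_one_pow]; norm_num
  · rw [(h2'.mul_left _).neg_one_pow]; norm_num
  · rw [(h1'.mul h2').neg_one_pow]; norm_num

/-- Substitute k = N u + M v: the exponential splits, and the Jacobi symbols modulo M and N pick up
(N/M) and (M/N). -/
lemma jacobiGauss_mul {M N : ℕ} (hM : 0 < M) (hN : 0 < N) (h : M.Coprime N) (a : ℤ) :
    jacobiGauss (M * N) a = J(N | M) * J(M | N) * (jacobiGauss M a * jacobiGauss N a) := by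
  have : NeZero M := ⟨hM.ne'⟩
  have : NeZero N := ⟨hN.ne'⟩
  have hM' : (M : ℂ) ≠ 0 := by exact_mod_cast hM.ne'
  have hN' : (N : ℂ) ≠ 0 := by exact_mod_cast hN.ne'
  rw [jacobiGauss, sum_range_mul_of_coprime hM hN h]
  · rw [jacobiGauss, jacobiGauss, Finset.sum_mul_sum, Finset.mul_sum]
    refine Finset.sum_congr rfl fun u _ => ?_
    rw [Finset.mul_sum]
    refine Finset.sum_congr rfl fun v _ => ?_
    have h1 : J((N * u + M * v : ℕ) | M) = J(N | M) * J(u | M) := by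
      rw [← jacobiSym.mul_left]
      apply jacobiSym.mod_left'
      push_cast
      simp
    have h2 : J((N * u + M * v : ℕ) | N) = J(M | N) * J(v | N) := by
      rw [← jacobiSym.mul_left]
      apply jacobiSym.mod_left'
      push_cast
      simp
    have h3 : Complex.exp (2 * Real.pi * Complex.I * (a * (N * u + M * v : ℕ)) / (M * N : ℕ)) =
        Complex.exp (2 * Real.pi * Complex.I * (a * u) / M) *
          Complex.exp (2 * Real.pi * Complex.I * (a * v) / N) := by
      rw [← Complex.exp_add]
      congr 1
      push_cast
      field_simp
    rw [jacobiSym.mul_right, h1, h2, h3]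
    push_cast
    ring
  · intro n
    rw [exp_two_pi_mul_mod a n (Nat.mul_pos hM hN), jacobiSym_natCast_mod]

lemma jacobiGauss_eq {N : ℕ} (hodd : Odd N) (hsq : Squarefree N) (a : ℤ) :
    jacobiGauss N a = J(a | N) * (gaussSign N * (√(N : ℝ) : ℂ)) := by
  induction N using induction_on_primes with
  | zero => exact absurd hodd (by decide)
  | one => simp [jacobiGauss, gaussSign]
  | prime_mul p N hp ih =>
    obtain ⟨hcop, -, hsqN⟩ := Nat.squarefree_mul_iff.1 hsq
    obtain ⟨hpo, hNo⟩ := Nat.odd_mul.1 hodd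
    have h2 : p ≠ 2 := by rintro rfl; exact absurd hpo (by decide)
    have : NeZero p := ⟨hp.ne_zero⟩
    have : NeZero N := ⟨hNo.pos.ne'⟩
    rw [jacobiGauss_mul hp.pos hNo.pos hcop, ih hNo hsqN, jacobiGauss_prime hp h2,
      jacobiSym.mul_right, jacobiSym.quadratic_reciprocity hpo hNo, Nat.cast_mul,
      Real.sqrt_mul (Nat.cast_nonneg p)]
    have hJ : ((J(N | p) : ℤ) : ℂ) ^ 2 = 1 := by
      exact_mod_cast jacobiSym.sq_one (by simpa using hcop.symm)
    have hs := gaussSign_mul hpo hNo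
    have hm : ((-1 : ℂ) ^ (p / 2 * (N / 2))) ^ 2 = 1 := by
      rw [← pow_mul, mul_comm, pow_mul]; simp
    push_cast
    linear_combination (J(a | p) * J(a | N) * √(p : ℝ) * √(N : ℝ) * (-1) ^ (p / 2 * (N / 2)) *
      gaussSign p * gaussSign N : ℂ) * hJ - (J(a | p) * J(a | N) * √(p : ℝ) * √(N : ℝ) *
      (-1) ^ (p / 2 * (N / 2)) : ℂ) * hs + (J(a | p) * J(a | N) * √(p : ℝ) * √(N : ℝ) *
      gaussSign (p * N) : ℂ) * hm

/-! ### The Kronecker symbol (-2q/·) and its Gauss sum modulo 8q. -/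

/-- The even or odd primitive character modulo `8` occurring in `J(-2q | ·)`. -/
def charEight (q : ℕ) : MulChar (ZMod 8) ℤ := if q % 4 = 1 then ZMod.χ₈' else ZMod.χ₈

/-- The Kronecker symbol `(-2q / ·)` for odd `q`. -/
def kronecker (q k : ℕ) : ℤ := charEight q k * J(k | q)

lemma charEight_of_even (q : ℕ) {k : ℕ} (hk : Even k) : charEight q k = 0 := by
  have h : k % 8 = 0 ∨ k % 8 = 2 ∨ k % 8 = 4 ∨ k % 8 = 6 := by
    rw [Nat.even_iff] at hk; omega
  rw [← ZMod.natCast_mod k 8]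
  unfold charEight
  split_ifs <;> rcases h with h | h | h | h <;> rw [h] <;> decide

lemma kronecker_of_even (q : ℕ) {k : ℕ} (hk : Even k) : kronecker q k = 0 := by
  rw [kronecker, charEight_of_even q hk, zero_mul]

lemma chi_four_mul_chi_eight' (k : ℕ) : ZMod.χ₈' k * ZMod.χ₄ k = ZMod.χ₈ k := by
  rw [ZMod.χ₈_nat_eq_if_mod_eight, ZMod.χ₄_nat_eq_if_mod_four, ZMod.χ₈'_nat_eq_if_mod_eight]
  split_ifs <;> first | rfl | omega

/-- Reciprocity exchanges q and k. For q ≡ 3 mod 4 it costs the sign χ₄(k), which turns χ₈' into χ₈;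
this explains the case distinction in `charEight`. -/
lemma jacobiSym_eq_kronecker {q k : ℕ} (hq : Odd q) (hk : Odd k) :
    J(-((2 * q : ℕ) : ℤ) | k) = kronecker q k := by
  have h1 : -((2 * q : ℕ) : ℤ) = -2 * q := by push_cast; ring
  rw [h1, jacobiSym.mul_left, jacobiSym.at_neg_two hk, kronecker, charEight,
    jacobiSym.quadratic_reciprocity hq hk]
  have hq' : q % 4 = 1 ∨ q % 4 = 3 := by rw [Nat.odd_iff] at hq; omega
  rcases hq' with h | h
  · rw [if_pos h, (Even.mul_right (by rw [Nat.even_iff]; omega) _ : Even (q / 2 * (k / 2))).neg_one_pow,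
      one_mul]
  · have hk2 : k % 2 = 1 := Nat.odd_iff.1 hk
    rw [if_neg (by omega), ← chi_four_mul_chi_eight', ZMod.χ₄_eq_neg_one_pow hk2, pow_mul,
      (show Odd (q / 2) by rw [Nat.odd_iff]; omega).neg_one_pow, mul_assoc]

/-- This product is the constant that the Chinese remainder substitution k = q u + 8 v produces in
the Gauss sum modulo 8q. -/
lemma charEight_mul_jacobiSym_eight {q : ℕ} (hq : Odd q) : charEight q q * J(8 | q) = 1 := by
  have h8 : J(8 | q) = ZMod.χ₈ q ^ 3 := by
    rw [← jacobiSym.at_two hq, show (8 : ℤ) = 2 * 2 * 2 by norm_num, jacobiSym.mul_left,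
      jacobiSym.mul_left]
    ring
  have h : q % 8 = 1 ∨ q % 8 = 3 ∨ q % 8 = 5 ∨ q % 8 = 7 := by
    rw [Nat.odd_iff] at hq; omega
  rw [h8, charEight]
  rcases h with h | h | h | h
  · rw [if_pos (by omega), ← ZMod.natCast_mod q 8, h]; decide
  · rw [if_neg (by omega), ← ZMod.natCast_mod q 8, h]; decide
  · rw [if_pos (by omega), ← ZMod.natCast_mod q 8, h]; decide
  · rw [if_neg (by omega), ← ZMod.natCast_mod q 8, h]; decide

lemma exp_two_pi_div_eight :
    Complex.exp (2 * Real.pi * Complex.I / 8) = (√2 / 2 : ℝ) * (1 + Complex.I) := by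
  rw [show 2 * (Real.pi : ℂ) * Complex.I / 8 = ((Real.pi / 4 : ℝ) : ℂ) * Complex.I by
    push_cast; ring, Complex.exp_mul_I, ← Complex.ofReal_cos, ← Complex.ofReal_sin,
    Real.cos_pi_div_four, Real.sin_pi_div_four]
  ring

/-- The Gauss sum modulo 8 is i√8 for the odd character and √8 for the even one; the factor
`gaussSign q` is 1 or i accordingly, so the product has one form for all odd q. -/
lemma sum_charEight {q : ℕ} (hq : Odd q) {l : ℕ} (hl : Odd l) :
    (∑ v ∈ Finset.range 8, (charEight q v : ℂ) *
      Complex.exp (2 * Real.pi * Complex.I * (l * v) / 8)) * gaussSign q =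
      charEight q l * (Complex.I * (√8 : ℝ)) := by
  set w := Complex.exp (2 * Real.pi * Complex.I / 8) with hw
  have hwv : w = (√2 / 2 : ℝ) * (1 + Complex.I) := exp_two_pi_div_eight
  have hs2 : ((√2 : ℝ) : ℂ) ^ 2 = 2 := by
    rw [← Complex.ofReal_pow, Real.sq_sqrt (by norm_num)]; norm_num
  have hs8 : ((√8 : ℝ) : ℂ) = 2 * (√2 : ℝ) := by
    rw [show (8 : ℝ) = 2 ^ 2 * 2 by norm_num, Real.sqrt_mul (by norm_num),
      Real.sqrt_sq (by norm_num)]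
    push_cast; ring
  have hI := Complex.I_sq
  have hw2 : w ^ 2 = Complex.I := by
    rw [hwv]
    push_cast
    linear_combination (1 + Complex.I) ^ 2 / 4 * hs2 + 1 / 2 * hI
  have hw4 : w ^ 4 = -1 := by
    rw [show w ^ 4 = (w ^ 2) ^ 2 by ring, hw2, hI]
  have hw8 : w ^ 8 = 1 := by rw [show w ^ 8 = (w ^ 4) ^ 2 by ring, hw4]; norm_num
  have hexp : ∀ v : ℕ, Complex.exp (2 * Real.pi * Complex.I * (l * v) / 8) = (w ^ (l % 8)) ^ v := by
    intro v
    rw [← pow_eq_pow_mod l hw8, hw, ← pow_mul, ← Complex.exp_nat_mul]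
    congr 1
    push_cast
    ring
  obtain ⟨z, hz⟩ : ∃ z, z = w ^ (l % 8) := ⟨_, rfl⟩
  have h : l % 8 = 1 ∨ l % 8 = 3 ∨ l % 8 = 5 ∨ l % 8 = 7 := by
    rw [Nat.odd_iff] at hl; omega
  simp only [hexp, ← hz]
  -- As l is odd, z is a primitive eighth root of unity, and the sum reduces to a combination of z
  -- and z³.
  have hz4 : z ^ 4 = -1 := by
    rw [hz, ← pow_mul, mul_comm, pow_mul, hw4, Odd.neg_one_pow]
    rw [Nat.odd_iff]; omega
  have hz5 : z ^ 5 = -z := by linear_combination z * hz4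
  have hz7 : z ^ 7 = -z ^ 3 := by linear_combination z ^ 3 * hz4
  have hsum : ∀ χ : MulChar (ZMod 8) ℤ, χ 0 = 0 → χ 2 = 0 → χ 4 = 0 → χ 6 = 0 →
      ∑ v ∈ Finset.range 8, (χ (v : ZMod 8) : ℂ) * z ^ v =
        (χ 1 - χ 5) * z + (χ 3 - χ 7) * z ^ 3 := by
    intro χ h0 h2 h4 h6
    simp only [Finset.sum_range_succ, Finset.sum_range_zero, hz5, hz7]
    simp only [Nat.cast_zero, Nat.cast_one, Nat.cast_ofNat, h0, h2, h4, h6, Int.cast_zero]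
    ring
  have hz' : (l % 8 = 1 ∧ z = w ∧ z ^ 3 = Complex.I * w) ∨
      (l % 8 = 3 ∧ z = Complex.I * w ∧ z ^ 3 = w) ∨
      (l % 8 = 5 ∧ z = -w ∧ z ^ 3 = -(Complex.I * w)) ∨
      (l % 8 = 7 ∧ z = -(Complex.I * w) ∧ z ^ 3 = -w) := by
    rcases h with h | h | h | h <;> rw [hz, h]
    · exact Or.inl ⟨rfl, pow_one w, by linear_combination w * hw2⟩
    · exact Or.inr (Or.inl ⟨rfl, by linear_combination w * hw2, by linear_combination w * hw8⟩)
    · exact Or.inr (Or.inr (Or.inl ⟨rfl, by linear_combination w * hw4,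
        by linear_combination w ^ 7 * hw8 + w ^ 3 * hw4 - w * hw2⟩))
    · exact Or.inr (Or.inr (Or.inr ⟨rfl, by linear_combination w ^ 3 * hw4 - w * hw2,
        by linear_combination w ^ 13 * hw8 + w ^ 5 * hw8 + w * hw4⟩))
  have e8 : (l : ZMod 8) = (l % 8 : ℕ) := (ZMod.natCast_mod l 8).symm
  rw [e8, hs8]
  have hq' : q % 4 = 1 ∨ q % 4 = 3 := by rw [Nat.odd_iff] at hq; omega
  rcases hq' with h4 | h4
  · rw [charEight, if_pos h4, gaussSign, if_pos h4,
      hsum _ (by decide) (by decide) (by decide) (by decide),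
      show ZMod.χ₈' 1 = 1 by decide, show ZMod.χ₈' 3 = 1 by decide,
      show ZMod.χ₈' 5 = -1 by decide, show ZMod.χ₈' 7 = -1 by decide]
    rcases hz' with ⟨hr, h1, h3⟩ | ⟨hr, h1, h3⟩ | ⟨hr, h1, h3⟩ | ⟨hr, h1, h3⟩ <;>
      rw [hr, h3, h1, hwv]
    · rw [show ZMod.χ₈' ((1 : ℕ) : ZMod 8) = 1 by decide]
      push_cast
      linear_combination (√2 : ℂ) * hI
    · rw [show ZMod.χ₈' ((3 : ℕ) : ZMod 8) = 1 by decide]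
      push_cast
      linear_combination (√2 : ℂ) * hI
    · rw [show ZMod.χ₈' ((5 : ℕ) : ZMod 8) = -1 by decide]
      push_cast
      linear_combination -(√2 : ℂ) * hI
    · rw [show ZMod.χ₈' ((7 : ℕ) : ZMod 8) = -1 by decide]
      push_cast
      linear_combination -(√2 : ℂ) * hI
  · rw [charEight, if_neg (by omega), gaussSign, if_neg (by omega),
      hsum _ (by decide) (by decide) (by decide) (by decide),
      show ZMod.χ₈ 1 = 1 by decide, show ZMod.χ₈ 3 = -1 by decide,
      show ZMod.χ₈ 5 = -1 by decide, show ZMod.χ₈ 7 = 1 by decide]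
    rcases hz' with ⟨hr, h1, h3⟩ | ⟨hr, h1, h3⟩ | ⟨hr, h1, h3⟩ | ⟨hr, h1, h3⟩ <;>
      rw [hr, h3, h1, hwv]
    · rw [show ZMod.χ₈ ((1 : ℕ) : ZMod 8) = 1 by decide]
      push_cast
      linear_combination -(√2 : ℂ) * Complex.I * hI
    · rw [show ZMod.χ₈ ((3 : ℕ) : ZMod 8) = -1 by decide]
      push_cast
      linear_combination (√2 : ℂ) * Complex.I * hI
    · rw [show ZMod.χ₈ ((5 : ℕ) : ZMod 8) = -1 by decide]
      push_cast
      linear_combination (√2 : ℂ) * Complex.I * hI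
    · rw [show ZMod.χ₈ ((7 : ℕ) : ZMod 8) = 1 by decide]
      push_cast
      linear_combination -(√2 : ℂ) * Complex.I * hI

lemma kronecker_mod (q n : ℕ) : kronecker q (n % (8 * q)) = kronecker q n := by
  have h1 : ((n % (8 * q) : ℕ) : ZMod 8) = n := by
    rw [ZMod.natCast_eq_natCast_iff]
    exact (Nat.mod_modEq n (8 * q)).of_mul_right q
  have h2 : J((n % (8 * q) : ℕ) | q) = J(n | q) := by
    rw [← jacobiSym_natCast_mod, Nat.mod_mul_left_mod, jacobiSym_natCast_mod]
  rw [kronecker, kronecker, h1, h2]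

/-- The Gauss sum of the Kronecker symbol `(-2q / ·)`. -/
lemma sum_kronecker_mul_exp {q : ℕ} (hq : Odd q) (hsq : Squarefree q) {l : ℕ} (hl : Odd l) :
    ∑ k ∈ Finset.range (8 * q), (kronecker q k : ℂ) *
      Complex.exp (2 * Real.pi * Complex.I * (l * k) / (8 * q : ℕ)) =
      kronecker q l * (Complex.I * (√(8 * q) : ℝ)) := by
  have hq0 : 0 < q := hq.pos
  have hqC : (q : ℂ) ≠ 0 := by exact_mod_cast hq0.ne'
  have hcop : Nat.Coprime 8 q := by
    rw [show 8 = 2 ^ 3 by norm_num]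
    exact Nat.Coprime.pow_left 3 (Nat.coprime_two_left.2 hq)
  rw [sum_range_mul_of_coprime (by norm_num) hq0 hcop]
  · have hG := jacobiGauss_eq hq hsq l
    have h8 := sum_charEight hq hl
    have hc : ((charEight q q : ℤ) : ℂ) * (J(8 | q) : ℤ) = 1 := by
      exact_mod_cast charEight_mul_jacobiSym_eight hq
    have hprod : ∑ u ∈ Finset.range 8, ∑ v ∈ Finset.range q,
        (kronecker q (q * u + 8 * v) : ℂ) *
          Complex.exp (2 * Real.pi * Complex.I * (l * (q * u + 8 * v : ℕ)) / (8 * q : ℕ)) =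
        (charEight q q * (J(8 | q) : ℤ)) * ((∑ v ∈ Finset.range 8, (charEight q v : ℂ) *
          Complex.exp (2 * Real.pi * Complex.I * (l * v) / 8)) * jacobiGauss q l) := by
      rw [jacobiGauss, Finset.sum_mul_sum, Finset.mul_sum]
      refine Finset.sum_congr rfl fun u _ => ?_
      rw [Finset.mul_sum]
      refine Finset.sum_congr rfl fun v _ => ?_
      have h1 : charEight q ((q * u + 8 * v : ℕ) : ZMod 8) = charEight q q * charEight q u := by
        rw [← map_mul]
        congr 1
        push_cast
        rw [show (8 : ZMod 8) = 0 by decide]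
        ring
      have h2 : J((q * u + 8 * v : ℕ) | q) = J(8 | q) * J(v | q) := by
        rw [← jacobiSym.mul_left]
        apply jacobiSym.mod_left'
        push_cast
        simp
      have h3 : Complex.exp (2 * Real.pi * Complex.I * (l * (q * u + 8 * v : ℕ)) / (8 * q : ℕ)) =
          Complex.exp (2 * Real.pi * Complex.I * (l * u) / 8) *
            Complex.exp (2 * Real.pi * Complex.I * ((l : ℤ) * v) / q) := by
        rw [← Complex.exp_add]
        congr 1
        push_cast
        field_simp
      rw [kronecker, h1, h2, h3]
      push_cast
      ring
    rw [hprod, hc, one_mul, hG, kronecker, Real.sqrt_mul (by norm_num)]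
    push_cast at h8 ⊢
    linear_combination ((J(l | q) : ℤ) : ℂ) * (√(q : ℝ) : ℂ) * h8
  · intro n
    have := exp_two_pi_mul_mod l n (Nat.mul_pos (show 0 < 8 by norm_num) hq0)
    push_cast at this ⊢
    rw [kronecker_mod, this]

/-! ### Symmetries of the Kronecker symbol and the finite sine and cosine expansions. -/

lemma kronecker_add_four_mul {q : ℕ} (hq : Odd q) (k : ℕ) :
    kronecker q (k + 4 * q) = -kronecker q k := by
  have h1 : charEight q ((k + 4 * q : ℕ) : ZMod 8) = -charEight q k := by
    have h4 : ((k + 4 * q : ℕ) : ZMod 8) = k + 4 := by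
      rw [← Nat.cast_ofNat (R := ZMod 8), ← Nat.cast_add, ZMod.natCast_eq_natCast_iff, Nat.ModEq]
      rw [Nat.odd_iff] at hq
      omega
    rw [h4]
    generalize (k : ZMod 8) = x
    unfold charEight
    split_ifs <;> revert x <;> decide
  have h2 : J((k + 4 * q : ℕ) | q) = J(k | q) := by
    apply jacobiSym.mod_left'
    push_cast
    simp
  rw [kronecker, kronecker, h1, h2, neg_mul]

/-- The symbol is odd (`hm1`) and changes sign under translation by 4q; the two signs cancel. -/
lemma kronecker_four_mul_sub {q : ℕ} (hq : Odd q) {k : ℕ} (hk : k ≤ 4 * q) :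
    kronecker q (4 * q - k) = kronecker q k := by
  have hm1 : charEight q (-1) * J(-1 | q) = -1 := by
    rw [jacobiSym.at_neg_one hq, ZMod.χ₄_nat_eq_if_mod_four, charEight]
    have hq' : q % 4 = 1 ∨ q % 4 = 3 := by rw [Nat.odd_iff] at hq; omega
    rcases hq' with h | h
    · rw [if_pos h, if_neg (by omega), if_pos h]; decide
    · rw [if_neg (by omega), if_neg (by omega), if_neg (by omega)]; decide
  have h1 : charEight q ((4 * q - k : ℕ) : ZMod 8) = -(charEight q (-1) * charEight q k) := by
    have h4 : ((4 * q - k : ℕ) : ZMod 8) = -1 * k + 4 := by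
      have : ((4 * q : ℕ) : ZMod 8) = (4 : ℕ) := by
        rw [ZMod.natCast_eq_natCast_iff, Nat.ModEq]
        rw [Nat.odd_iff] at hq
        omega
      rw [Nat.cast_sub hk, this]
      push_cast
      ring
    rw [h4]
    generalize (k : ZMod 8) = x
    unfold charEight
    split_ifs <;> revert x <;> decide
  have h2 : J((4 * q - k : ℕ) | q) = J(-1 | q) * J(k | q) := by
    rw [← jacobiSym.mul_left]
    apply jacobiSym.mod_left'
    rw [Nat.cast_sub hk]
    push_cast
    exact Int.modEq_iff_dvd.2 ⟨-4, by ring⟩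
  rw [kronecker, kronecker, h1, h2]
  linear_combination -(charEight q k * J(k | q)) * hm1

lemma sum_range_two_mul_of_reflect {n : ℕ} (f : ℕ → ℂ) (h0 : f 0 = 0) (hn : f n = 0)
    (hf : ∀ k ≤ 2 * n, f (2 * n - k) = f k) :
    ∑ k ∈ Finset.range (2 * n), f k = 2 * ∑ k ∈ Finset.range n, f k := by
  rw [two_mul n, Finset.sum_range_add, two_mul]
  congr 1
  have h1 : ∑ k ∈ Finset.range n, f (n + k) = ∑ k ∈ Finset.range (n + 1), f (n + k) := by
    rw [Finset.sum_range_succ, ← two_mul, ← Nat.sub_zero (2 * n), hf 0 (by omega), h0, add_zero]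
  have h2 : ∑ k ∈ Finset.range n, f k = ∑ k ∈ Finset.range (n + 1), f k := by
    rw [Finset.sum_range_succ, hn, add_zero]
  rw [h1, h2, ← Finset.sum_range_reflect]
  refine Finset.sum_congr rfl fun k hk => ?_
  rw [Finset.mem_range] at hk
  rw [← hf k (by omega)]
  congr 1
  omega

lemma exp_nat_mul_pi_I_of_odd {l : ℕ} (hl : Odd l) :
    Complex.exp (l * (Real.pi * Complex.I)) = -1 := by
  rw [Complex.exp_nat_mul, Complex.exp_pi_mul_I, hl.neg_one_pow]

/-- For odd l both the symbol and the exponential change sign under k ↦ k + 4q, which halves the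
range. The reflection k ↦ 4q - k sends exp(iφ) to -exp(-iφ), leaving only sines, and then folds the
range again at 2q. -/
lemma sum_kronecker_mul_sin {q : ℕ} (hq : Odd q) (hsq : Squarefree q) {l : ℕ} (hl : Odd l) :
    4 * ∑ k ∈ Finset.range (2 * q), (kronecker q k : ℂ) *
      Complex.sin (Real.pi * (l * k) / (4 * q)) = kronecker q l * (√(8 * q) : ℝ) := by
  have hq0 : (q : ℂ) ≠ 0 := by exact_mod_cast hq.pos.ne'
  have hS := sum_kronecker_mul_exp hq hsq hl
  set e : ℕ → ℂ := fun k => Complex.exp (2 * Real.pi * Complex.I * (l * k) / (8 * q : ℕ)) with he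
  have heq : ∀ k, e k = Complex.exp (Real.pi * (l * k) / (4 * q) * Complex.I) := by
    intro k
    simp only [he]
    congr 1
    push_cast
    field_simp
    ring
  have hK0 : kronecker q 0 = 0 := kronecker_of_even q (by decide)
  have h1 : ∑ k ∈ Finset.range (8 * q), (kronecker q k : ℂ) * e k =
      2 * ∑ k ∈ Finset.range (4 * q), (kronecker q k : ℂ) * e k := by
    rw [show 8 * q = 4 * q + 4 * q by ring, Finset.sum_range_add, two_mul]
    congr 1
    refine Finset.sum_congr rfl fun k _ => ?_
    have : e (4 * q + k) = -e k := by
      rw [heq, heq, ← neg_one_mul, ← exp_nat_mul_pi_I_of_odd hl, ← Complex.exp_add]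
      congr 1
      push_cast
      field_simp
    rw [this, add_comm, kronecker_add_four_mul hq]
    push_cast
    ring
  have h2 : ∑ k ∈ Finset.range (4 * q), (kronecker q k : ℂ) * e k =
      ∑ k ∈ Finset.range (4 * q), (kronecker q k : ℂ) *
        -Complex.exp (-(Real.pi * (l * k) / (4 * q)) * Complex.I) := by
    have h3 : ∀ f : ℕ → ℂ, f 0 = 0 → ∑ k ∈ Finset.range (4 * q + 1), f k =
        ∑ k ∈ Finset.range (4 * q), f (k + 1) := by
      intro f hf
      rw [Finset.sum_range_succ', hf, add_zero]
    have h4 : ∀ f : ℕ → ℂ, f (4 * q) = 0 → ∑ k ∈ Finset.range (4 * q + 1), f k =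
        ∑ k ∈ Finset.range (4 * q), f k := by
      intro f hf
      rw [Finset.sum_range_succ, hf, add_zero]
    have hK4 : kronecker q (4 * q) = 0 := kronecker_of_even q ⟨2 * q, by ring⟩
    rw [← h4 _ (by simp [hK4]), ← h4 _ (by simp [hK4]), ← Finset.sum_range_reflect]
    refine Finset.sum_congr rfl fun k hk => ?_
    have hk' : k ≤ 4 * q := by rw [Finset.mem_range] at hk; omega
    rw [show 4 * q + 1 - 1 - k = 4 * q - k by omega, kronecker_four_mul_sub hq hk', heq]
    congr 1
    rw [← neg_one_mul, ← exp_nat_mul_pi_I_of_odd hl, ← Complex.exp_add, Nat.cast_sub hk']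
    congr 1
    push_cast
    field_simp
    ring
  have h5 : 2 * ∑ k ∈ Finset.range (4 * q), (kronecker q k : ℂ) * e k =
      2 * Complex.I * ∑ k ∈ Finset.range (4 * q), (kronecker q k : ℂ) *
        Complex.sin (Real.pi * (l * k) / (4 * q)) := by
    rw [two_mul]
    nth_rewrite 2 [h2]
    rw [← Finset.sum_add_distrib, Finset.mul_sum]
    refine Finset.sum_congr rfl fun k _ => ?_
    rw [heq, Complex.sin]
    linear_combination (kronecker q k : ℂ) *
      (Complex.exp (Real.pi * (l * k) / (4 * q) * Complex.I) -
        Complex.exp (-(Real.pi * (l * k) / (4 * q)) * Complex.I)) * Complex.I_sq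
  have h6 : ∑ k ∈ Finset.range (2 * (2 * q)), (kronecker q k : ℂ) *
      Complex.sin (Real.pi * (l * k) / (4 * q)) = 2 * ∑ k ∈ Finset.range (2 * q),
        (kronecker q k : ℂ) * Complex.sin (Real.pi * (l * k) / (4 * q)) := by
    apply sum_range_two_mul_of_reflect
    · simp
    · simp [kronecker_of_even q ⟨q, two_mul q⟩]
    · intro k hk
      have hk' : k ≤ 4 * q := by omega
      rw [show 2 * (2 * q) - k = 4 * q - k by omega, kronecker_four_mul_sub hq hk']
      congr 1
      have harg : (Real.pi : ℂ) * (l * (4 * q - k : ℕ)) / (4 * q) =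
          l * Real.pi - Real.pi * (l * k) / (4 * q) := by
        rw [Nat.cast_sub hk']
        push_cast
        field_simp
      have hcos : Complex.cos (l * Real.pi) = -1 := by
        have := Real.cos_nat_mul_pi l
        rw [hl.neg_one_pow] at this
        exact_mod_cast congrArg Complex.ofReal this
      rw [harg, Complex.sin_sub, Complex.sin_nat_mul_pi, hcos]
      ring
  rw [h1, h5, show 4 * q = 2 * (2 * q) by ring, h6] at hS
  have hI : Complex.I ≠ 0 := Complex.I_ne_zero
  apply mul_left_cancel₀ hI
  linear_combination hS

/-- The finite Fourier expansion of `J(-m | l)`, `m = 2q`, over the odd numbers below `m`. -/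
lemma kronecker_eq_sum_sin {m q : ℕ} (hm : m = 2 * q) (hq : Odd q) (hsq : Squarefree q) {l : ℕ}
    (hl : Odd l) :
    (kronecker q l : ℝ) = 2 / √(m : ℝ) * ∑ k ∈ (Finset.Icc 1 (m - 1)).filter (fun k => Odd k),
      (kronecker q k : ℝ) * Real.sin (k * ((l : ℝ) * (Real.pi / (2 * m)))) := by
  have h := sum_kronecker_mul_sin hq hsq hl
  have hm0 : (0 : ℝ) < m := by rw [hm]; have := hq.pos; positivity
  have hsub : ∑ k ∈ Finset.range (2 * q), (kronecker q k : ℝ) *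
      Real.sin (k * ((l : ℝ) * (Real.pi / (2 * m)))) =
      ∑ k ∈ (Finset.Icc 1 (m - 1)).filter (fun k => Odd k), (kronecker q k : ℝ) *
      Real.sin (k * ((l : ℝ) * (Real.pi / (2 * m)))) := by
    symm
    apply Finset.sum_subset
    · intro k hk
      simp only [Finset.mem_filter, Finset.mem_Icc, Finset.mem_range] at hk ⊢
      omega
    · intro k hk hk'
      have : Even k := by
        rw [← Nat.not_odd_iff_even]
        intro ho
        apply hk'
        have := ho.pos
        simp only [Finset.mem_filter, Finset.mem_Icc, Finset.mem_range] at hk ⊢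
        exact ⟨by omega, ho⟩
      rw [kronecker_of_even q this]
      simp
  have hR : 4 * ∑ k ∈ Finset.range (2 * q), (kronecker q k : ℝ) *
      Real.sin (k * ((l : ℝ) * (Real.pi / (2 * m)))) = kronecker q l * √(8 * q) := by
    have : ∀ k : ℕ, Complex.sin (Real.pi * (l * k) / (4 * q)) =
        (Real.sin (k * ((l : ℝ) * (Real.pi / (2 * m)))) : ℂ) := by
      intro k
      rw [Complex.ofReal_sin]
      congr 1
      rw [hm]
      push_cast
      ring
    simp only [this] at h
    exact_mod_cast h
  have h8 : √(8 * q : ℝ) = 2 * √(m : ℝ) := by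
    rw [show (8 * q : ℝ) = 2 ^ 2 * m by rw [hm]; push_cast; ring, Real.sqrt_mul (by norm_num),
      Real.sqrt_sq (by norm_num)]
  rw [hsub, h8] at hR
  have hs : √(m : ℝ) ≠ 0 := (Real.sqrt_pos.2 hm0).ne'
  rw [eq_comm, div_mul_eq_mul_div, div_eq_iff hs]
  linear_combination hR / 2

/-- The finite Fourier expansion of `J(m | l)`, `m = 2q`, over the odd numbers below `m`. -/
lemma jacobiSym_eq_sum_cos {m q : ℕ} (hm : m = 2 * q) (hq : Odd q) (hsq : Squarefree q) {l : ℕ}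
    (hl : Odd l) :
    (J((m : ℤ) | l) : ℝ) = 2 / √(m : ℝ) *
      ∑ k ∈ (Finset.Icc 1 (m - 1)).filter (fun k => Odd k),
        (kronecker q k : ℝ) * Real.cos ((m - k) * ((l : ℝ) * (Real.pi / (2 * m)))) := by
  have hm0 : (m : ℝ) ≠ 0 := by rw [hm]; have := hq.pos; positivity
  have hJ : J((m : ℤ) | l) = kronecker q l * ZMod.χ₄ l := by
    rw [← jacobiSym_eq_kronecker hq hl, ← jacobiSym.at_neg_one hl, ← jacobiSym.mul_left, ← hm]
    simp
  -- Multiplication by χ₄(l) = sin(lπ/2) turns sin(kθ) into cos(lπ/2 - kθ) = cos((m-k)θ), where θ =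
  -- lπ/(2m).
  have hcos : Real.cos ((l : ℝ) * (Real.pi / 2)) = 0 ∧
      Real.sin ((l : ℝ) * (Real.pi / 2)) = (ZMod.χ₄ l : ℤ) := by
    obtain ⟨j, rfl⟩ := hl
    have h : (((2 * j + 1 : ℕ) : ℝ)) * (Real.pi / 2) = Real.pi / 2 + j * Real.pi := by
      push_cast; ring
    rw [h, Real.cos_add_nat_mul_pi, Real.sin_add_nat_mul_pi, Real.cos_pi_div_two,
      Real.sin_pi_div_two, ZMod.χ₄_eq_neg_one_pow (by omega), show (2 * j + 1) / 2 = j by omega]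
    simp
  rw [hJ, Int.cast_mul, kronecker_eq_sum_sin hm hq hsq hl, mul_assoc, Finset.sum_mul]
  congr 1
  refine Finset.sum_congr rfl fun k _ => ?_
  rw [show ((m : ℝ) - k) * ((l : ℝ) * (Real.pi / (2 * m))) =
    l * (Real.pi / 2) - k * ((l : ℝ) * (Real.pi / (2 * m))) by field_simp, Real.cos_sub,
    hcos.1, hcos.2]
  ring

/-! ### The square wave series, via the Riemann–Lebesgue lemma. -/

lemma two_mul_sin_mul_sum_cos_odd (u : ℝ) (N : ℕ) :
    2 * Real.sin u * ∑ j ∈ Finset.range N, Real.cos ((2 * j + 1) * u) = Real.sin (2 * N * u) := by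
  induction N with
  | zero => simp
  | succ n ih =>
    rw [Finset.sum_range_succ, mul_add, ih]
    have h1 : 2 * ((n + 1 : ℕ) : ℝ) * u = (2 * n + 1) * u + u := by push_cast; ring
    have h2 : 2 * (n : ℝ) * u = (2 * n + 1) * u - u := by ring
    rw [h1, h2, Real.sin_add, Real.sin_sub]
    ring

lemma tendsto_integral_sin_mul (f : ℝ → ℝ) (a b : ℝ) (hab : a ≤ b)
    (hf : ContinuousOn f (Set.Icc a b)) :
    Tendsto (fun N : ℕ => ∫ u in a..b, Real.sin (2 * N * u) * f u) atTop (𝓝 0) := by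
  have hRL := Real.tendsto_integral_exp_smul_cocompact
    ((Set.Ioc a b).indicator fun u => (f u : ℂ))
  -- With the kernel exp(-2πivw), the frequency w = -N/π yields exp(2iNv), whose imaginary part is
  -- the required sine.
  have hseq : Tendsto (fun N : ℕ => -((N : ℝ) / Real.pi)) atTop (cocompact ℝ) := by
    rw [cocompact_eq_atBot_atTop]
    refine Tendsto.mono_right ?_ le_sup_left
    exact tendsto_neg_atTop_atBot.comp
      (tendsto_natCast_atTop_atTop.atTop_div_const Real.pi_pos)
  have h := (Complex.continuous_im.tendsto 0).comp (hRL.comp hseq)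
  rw [Complex.zero_im] at h
  refine h.congr fun N => ?_
  have h1 : ∫ v : ℝ, Real.fourierChar (-(v * -((N : ℝ) / Real.pi))) •
      (Set.Ioc a b).indicator (fun u => (f u : ℂ)) v =
      ∫ v in a..b, Complex.exp ((2 * N * v : ℝ) * Complex.I) * (f v : ℂ) := by
    rw [intervalIntegral.integral_of_le hab, ← MeasureTheory.integral_indicator measurableSet_Ioc]
    congr 1
    ext v
    by_cases hv : v ∈ Set.Ioc a b
    · rw [Set.indicator_of_mem hv, Set.indicator_of_mem hv, Circle.smul_def, smul_eq_mul,
        Real.fourierChar_apply]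
      congr 3
      have := Real.pi_ne_zero
      push_cast
      field_simp
    · rw [Set.indicator_of_notMem hv, Set.indicator_of_notMem hv, smul_zero]
  have hint : IntervalIntegrable
      (fun v : ℝ => Complex.exp ((2 * N * v : ℝ) * Complex.I) * (f v : ℂ))
      MeasureTheory.volume a b := by
    apply ContinuousOn.intervalIntegrable
    rw [Set.uIcc_of_le hab]
    refine ContinuousOn.mul (by fun_prop) ?_
    exact Complex.continuous_ofReal.comp_continuousOn hf
  simp only [Function.comp_apply, h1]
  have h2 := Complex.imCLM.intervalIntegral_comp_comm hint
  simp only [Complex.imCLM_apply] at h2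
  rw [← h2]
  refine intervalIntegral.integral_congr fun v _ => ?_
  simp only [Complex.mul_im, Complex.ofReal_re, Complex.ofReal_im, Complex.exp_ofReal_mul_I_im]
  ring

/-- The Fourier series of a square wave. -/
lemma tendsto_sum_sin_odd {y : ℝ} (hy : 0 < y) (hy2 : y ≤ Real.pi / 2) :
    Tendsto (fun N : ℕ => ∑ j ∈ Finset.range N, Real.sin ((2 * j + 1) * y) / (2 * j + 1)) atTop
      (𝓝 (Real.pi / 4)) := by
  have hsin : ∀ u ∈ Set.Icc y (Real.pi / 2), 0 < Real.sin u := fun u hu =>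
    Real.sin_pos_of_pos_of_lt_pi (hy.trans_le hu.1) (by linarith [hu.2, Real.pi_pos])
  have hI := tendsto_integral_sin_mul (fun u => (2 * Real.sin u)⁻¹) y (Real.pi / 2) hy2
    (ContinuousOn.inv₀ (by fun_prop) fun u hu => by have := hsin u hu; positivity)
  -- At y = π/2 the series is Leibniz's series for π/4. The difference from a general y is the
  -- integral from y to π/2 of the cosine sum sin(2Nu)/(2 sin u), which tends to 0 as y stays away
  -- from 0.
  have h := Real.tendsto_sum_pi_div_four.sub hI
  rw [sub_zero] at h
  refine h.congr fun N => ?_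
  have h1 : ∫ u in y..(Real.pi / 2), Real.sin (2 * N * u) * (2 * Real.sin u)⁻¹ =
      ∫ u in y..(Real.pi / 2), ∑ j ∈ Finset.range N, Real.cos ((2 * j + 1) * u) := by
    refine intervalIntegral.integral_congr fun u hu => ?_
    rw [Set.uIcc_of_le hy2] at hu
    have := hsin u hu
    rw [← two_mul_sin_mul_sum_cos_odd, mul_comm, ← mul_assoc, inv_mul_cancel₀ (by positivity),
      one_mul]
  rw [h1, intervalIntegral.integral_finsetSum fun (j : ℕ) _ =>
    (by fun_prop : Continuous fun u : ℝ => Real.cos ((2 * (j : ℝ) + 1) * u)).intervalIntegrable _ _,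
    ← Finset.sum_sub_distrib]
  refine Finset.sum_congr rfl fun j _ => ?_
  have hj : (2 * j + 1 : ℝ) ≠ 0 := by positivity
  rw [intervalIntegral.integral_comp_mul_left (fun u => Real.cos u) hj, integral_cos, smul_eq_mul]
  have h2 : Real.sin ((2 * j + 1) * (Real.pi / 2)) = (-1) ^ j := by
    rw [show (2 * j + 1 : ℝ) * (Real.pi / 2) = Real.pi / 2 + j * Real.pi by ring,
      Real.sin_add_nat_mul_pi, Real.sin_pi_div_two, mul_one]
  rw [h2]
  field_simp
  ring

/-! ### Fourier series of antiperiodic functions. -/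

/-- The Fourier series of a continuous function with `F T = -F 0`, antiperiodically extended. -/
lemma hasSum_fourier_antiperiodic {T : ℝ} (hT : 0 < T) {F : ℝ → ℂ} (hF : Continuous F)
    (hFT : F T = -F 0) (C : ℤ → ℂ)
    (hC : ∀ n : ℤ, ∫ y in (0 : ℝ)..T,
      Complex.exp (-(Complex.I * ((2 * n + 1) * Real.pi / T) * y)) * F y = T * C n)
    (hCs : Summable C) {y : ℝ} (hy : y ∈ Set.Ico 0 T) :
    HasSum (fun n : ℤ => C n * Complex.exp (Complex.I * ((2 * n + 1) * Real.pi / T) * y)) (F y) := by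
  have : Fact (0 < T) := ⟨hT⟩
  have hTC : (T : ℂ) ≠ 0 := by exact_mod_cast hT.ne'
  -- The half-frequency twist makes the antiperiodic function periodic, so that it descends to a
  -- continuous function on the circle of length T.
  let G : ℝ → ℂ := fun y => Complex.exp (-(Complex.I * (Real.pi / T) * y)) * F y
  have hG : Continuous G := by fun_prop
  have hG0 : G 0 = G (0 + T) := by
    simp only [G, zero_add, hFT]
    rw [show -(Complex.I * (Real.pi / T) * T) = -(Real.pi * Complex.I) by field_simp,
      Complex.exp_neg (Real.pi * Complex.I), Complex.exp_pi_mul_I]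
    norm_num
  let g : C(AddCircle T, ℂ) := ⟨AddCircle.liftIco T 0 G,
    AddCircle.liftIco_continuous hG0 hG.continuousOn⟩
  have hcoef : ∀ n, fourierCoeff (g : AddCircle T → ℂ) n = C n := by
    intro n
    change fourierCoeff (AddCircle.liftIco T 0 G) n = C n
    rw [fourierCoeff_liftIco_eq, fourierCoeffOn_eq_integral, zero_add, sub_zero]
    have : ∫ x in (0 : ℝ)..T, (fourier (-n)) (x : AddCircle (T : ℝ)) • G x = T * C n := by
      rw [← hC n]
      refine intervalIntegral.integral_congr fun x _ => ?_
      simp only [G, smul_eq_mul]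
      rw [fourier_coe_apply, ← mul_assoc, ← Complex.exp_add]
      congr 2
      push_cast
      field_simp
      ring
    rw [this, Complex.real_smul]
    push_cast
    field_simp
  have hs : Summable (fourierCoeff (g : AddCircle T → ℂ)) := by
    rw [show fourierCoeff (g : AddCircle T → ℂ) = C from funext hcoef]; exact hCs
  have h := has_pointwise_sum_fourier_series_of_summable hs (y : AddCircle T)
  have hgy : g (y : AddCircle T) = G y := by
    change AddCircle.liftIco T 0 G y = G y
    exact AddCircle.liftIco_coe_apply (by simpa using hy)
  rw [hgy] at h
  have h' := h.mul_left (Complex.exp (Complex.I * (Real.pi / T) * y))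
  have e1 : Complex.exp (Complex.I * (Real.pi / T) * y) * G y = F y := by
    simp only [G]
    rw [← mul_assoc, ← Complex.exp_add]
    simp
  rw [e1] at h'
  have hfun : ∀ n : ℤ, C n * Complex.exp (Complex.I * ((2 * n + 1) * Real.pi / T) * y) =
      Complex.exp (Complex.I * (Real.pi / T) * y) *
        (fourierCoeff (g : AddCircle T → ℂ) n • fourier n (y : AddCircle T)) := by
    intro n
    rw [hcoef, fourier_coe_apply, smul_eq_mul, mul_left_comm, ← Complex.exp_add]
    congr 2
    field_simp
    ring
  simp only [hfun]
  exact h'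

/-! ### Sums of simple fractions and their power series. -/

/-- For ‖x‖ < r the denominators grow quadratically in j with a constant independent of j, so
bounded numerators give summable series. -/
lemma mul_sq_le_norm_sq_sub {r : ℝ} (hr : 0 < r) (x : ℂ) (j : ℕ) :
    (1 - ‖x‖ ^ 2 / r ^ 2) * ((2 * j + 1) * r) ^ 2 ≤ ‖(((2 * j + 1) * r : ℝ) : ℂ) ^ 2 - x ^ 2‖ := by
  have h1 : r ^ 2 ≤ ((2 * j + 1) * r) ^ 2 := by
    rw [mul_pow]
    have : (1 : ℝ) ≤ (2 * j + 1) ^ 2 := by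
      have : (0 : ℝ) ≤ j := Nat.cast_nonneg j
      nlinarith
    nlinarith [sq_nonneg r]
  have h2 : ‖x‖ ^ 2 ≤ ‖x‖ ^ 2 / r ^ 2 * ((2 * j + 1) * r) ^ 2 := by
    rw [div_mul_eq_mul_div, le_div_iff₀ (by positivity)]
    exact mul_le_mul_of_nonneg_left h1 (by positivity)
  have h3 := norm_sub_norm_le ((((2 * j + 1) * r : ℝ) : ℂ) ^ 2) (x ^ 2)
  rw [norm_pow, norm_pow, Complex.norm_real, Real.norm_eq_abs, sq_abs] at h3
  linarith

lemma one_sub_norm_sq_pos {r : ℝ} (hr : 0 < r) {x : ℂ} (hx : ‖x‖ < r) :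
    0 < 1 - ‖x‖ ^ 2 / r ^ 2 := by
  rw [sub_pos, div_lt_one (by positivity)]
  exact pow_lt_pow_left₀ hx (norm_nonneg x) two_ne_zero

lemma sq_sub_sq_ne_zero {r : ℝ} (hr : 0 < r) {x : ℂ} (hx : ‖x‖ < r) (j : ℕ) :
    (((2 * j + 1) * r : ℝ) : ℂ) ^ 2 - x ^ 2 ≠ 0 := by
  rw [← norm_pos_iff]
  refine lt_of_lt_of_le ?_ (mul_sq_le_norm_sq_sub hr x j)
  have := one_sub_norm_sq_pos hr hx
  positivity

lemma summable_one_div_odd_sq : Summable fun j : ℕ => 1 / (2 * (j : ℝ) + 1) ^ 2 := by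
  have h := (Real.summable_one_div_nat_pow (p := 2)).2 one_lt_two
  have := h.comp_injective (i := fun j : ℕ => 2 * j + 1) fun a b hab => by simpa using hab
  refine this.congr fun j => ?_
  simp

lemma summable_div_sq_sub_sq {r : ℝ} (hr : 0 < r) {x : ℂ} (hx : ‖x‖ < r) {b : ℕ → ℂ} {B : ℝ}
    (hb : ∀ j, ‖b j‖ ≤ B) :
    Summable fun j : ℕ => b j / ((((2 * j + 1) * r : ℝ) : ℂ) ^ 2 - x ^ 2) := by
  have hδ := one_sub_norm_sq_pos hr hx
  refine Summable.of_norm_bounded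
    (summable_one_div_odd_sq.mul_left (B / ((1 - ‖x‖ ^ 2 / r ^ 2) * r ^ 2))) fun j => ?_
  rw [norm_div]
  have h1 := mul_sq_le_norm_sq_sub hr x j
  have hB : 0 ≤ B := (norm_nonneg _).trans (hb j)
  calc ‖b j‖ / ‖(((2 * j + 1) * r : ℝ) : ℂ) ^ 2 - x ^ 2‖
      ≤ B / ((1 - ‖x‖ ^ 2 / r ^ 2) * ((2 * j + 1) * r) ^ 2) :=
        div_le_div₀ hB (hb j) (by positivity) h1
    _ = _ := by rw [mul_pow, div_mul_div_comm, mul_one]; congr 1; ring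

/-- Expansion of a sum of simple fractions into a power series. -/
lemma hasSum_pow_of_partial_fractions {r : ℝ} (hr : 0 < r) {x : ℂ} (hx : ‖x‖ < r) {b : ℕ → ℂ}
    {B : ℝ} (hb : ∀ j, ‖b j‖ ≤ B) :
    HasSum (fun n : ℕ => (∑' j : ℕ, b j / (((2 * j + 1) * r : ℝ) : ℂ) ^ (2 * n + 2)) * x ^ (2 * n))
      (∑' j : ℕ, b j / ((((2 * j + 1) * r : ℝ) : ℂ) ^ 2 - x ^ 2)) := by
  set a : ℕ → ℝ := fun j => (2 * j + 1) * r with ha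
  have ha0 : ∀ j, 0 < a j := fun j => by positivity
  have hra : ∀ j, r ≤ a j := fun j => by
    have : (0 : ℝ) ≤ j := Nat.cast_nonneg j
    simp only [ha]
    nlinarith
  -- The double series is absolutely summable, dominated by 1/(2j+1)² times a geometric sequence.
  -- Its rows sum to the simple fractions and its columns to the power series coefficients.
  let f : ℕ × ℕ → ℂ := fun p => b p.1 / (a p.1 : ℂ) ^ 2 * (x ^ 2 / (a p.1 : ℂ) ^ 2) ^ p.2
  have hf : Summable f := by
    have hρ : ‖x‖ ^ 2 / r ^ 2 < 1 := by linarith [one_sub_norm_sq_pos hr hx]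
    have h1 := (summable_one_div_odd_sq.mul_left (B / r ^ 2)).mul_of_nonneg
      (summable_geometric_of_lt_one (by positivity) hρ)
      (fun j => by have := (norm_nonneg _).trans (hb j); simp only [Pi.zero_apply]; positivity)
      (fun n => by simp only [Pi.zero_apply]; positivity)
    refine Summable.of_norm_bounded h1 ?_
    rintro ⟨j, n⟩
    have hB : 0 ≤ B := (norm_nonneg _).trans (hb j)
    simp only [f, norm_mul, norm_div, norm_pow, Complex.norm_real, Real.norm_eq_abs,
      abs_of_pos (ha0 j)]
    refine mul_le_mul ?_ ?_ (by positivity) (by positivity)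
    · simp only [ha]
      rw [mul_pow, div_mul_div_comm, mul_one, mul_comm (r ^ 2)]
      gcongr
      exact hb j
    · have := hra j
      gcongr
  have hrow : ∀ j, HasSum (fun n => f (j, n)) (b j / ((a j : ℂ) ^ 2 - x ^ 2)) := by
    intro j
    have ha0' : (a j : ℂ) ≠ 0 := by exact_mod_cast (ha0 j).ne'
    have hne := sq_sub_sq_ne_zero hr hx j
    have hlt : ‖x ^ 2 / (a j : ℂ) ^ 2‖ < 1 := by
      rw [norm_div, norm_pow, norm_pow, Complex.norm_real, Real.norm_eq_abs, sq_abs,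
        div_lt_one (by have := ha0 j; positivity)]
      exact pow_lt_pow_left₀ (hx.trans_le (hra j)) (norm_nonneg x) two_ne_zero
    have h := (hasSum_geometric_of_norm_lt_one hlt).mul_left (b j / (a j : ℂ) ^ 2)
    change (a j : ℂ) ^ 2 - x ^ 2 ≠ 0 at hne
    rw [one_sub_div (pow_ne_zero 2 ha0'), inv_div, div_mul_div_comm, mul_comm (b j),
      mul_div_mul_left _ _ (pow_ne_zero 2 ha0')] at h
    exact h
  have htot := hf.hasSum.prod_fiberwise hrow
  rw [htot.tsum_eq]
  have hswap : HasSum (fun p : ℕ × ℕ => f (p.2, p.1)) (∑' p, f p) :=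
    (Equiv.prodComm ℕ ℕ).hasSum_iff.2 hf.hasSum
  refine hswap.prod_fiberwise fun n => ?_
  have hcol : Summable fun j => f (j, n) := hswap.summable.prod_factor n
  convert hcol.hasSum using 1
  rw [← tsum_mul_right]
  refine tsum_congr fun j => ?_
  simp only [f, div_pow, ← pow_mul]
  rw [div_mul_div_comm, ← pow_add, div_mul_eq_mul_div, add_comm 2]

/-! ### Partial fractions with denominator cos(mx). -/

lemma cos_ne_zero_of_norm_lt {m : ℝ} (hm : 0 < m) {x : ℂ} (hx : ‖x‖ < Real.pi / (2 * m)) :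
    Complex.cos (m * x) ≠ 0 := by
  rw [Complex.cos_ne_zero_iff]
  intro k hk
  have h1 : ‖(m : ℂ) * x‖ < Real.pi / 2 := by
    rw [norm_mul, Complex.norm_real, Real.norm_eq_abs, abs_of_pos hm]
    calc m * ‖x‖ < m * (Real.pi / (2 * m)) := by gcongr
      _ = Real.pi / 2 := by field_simp
  rw [hk] at h1
  have h2 : ((2 * k + 1) * Real.pi / 2 : ℂ) = ((2 * k + 1 : ℤ) * (Real.pi / 2) : ℝ) := by
    push_cast; ring
  rw [h2, Complex.norm_real, Real.norm_eq_abs, abs_mul, abs_of_pos (by positivity : 0 < Real.pi / 2)]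
    at h1
  have h3 : (1 : ℝ) ≤ |((2 * k + 1 : ℤ) : ℝ)| := by
    rw [← Int.cast_abs]
    have : 1 ≤ |2 * k + 1| := Int.one_le_abs (by omega)
    exact_mod_cast this
  nlinarith [Real.pi_pos]

/-- A summability criterion for the Fourier coefficients over all odd frequencies. -/
lemma summable_int_odd {C : ℤ → ℂ} {D : ℕ → ℂ} (h1 : ∀ n : ℕ, C n = D n)
    (h2 : ∀ n : ℕ, C (-(n + 1)) = D n ∨ C (-(n + 1)) = -D n) (hD : Summable D) : Summable C := by
  refine Summable.of_nat_of_neg_add_one (hD.congr fun n => (h1 n).symm) ?_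
  refine Summable.of_norm_bounded hD.norm fun n => ?_
  rcases h2 n with h | h <;> rw [h]
  rw [norm_neg]

lemma integral_exp_mul_sin {m : ℝ} {a x : ℂ} (ha : a ^ 2 - x ^ 2 ≠ 0)
    (he : Complex.exp (-(Complex.I * a * (2 * m : ℝ))) = -1) :
    ∫ y in (0 : ℝ)..(2 * m), Complex.exp (-(Complex.I * a * y)) * Complex.sin ((m - y) * x) =
      2 * x * Complex.cos (m * x) / (a ^ 2 - x ^ 2) := by
  have hderiv : ∀ y : ℝ, HasDerivAt (fun y : ℝ => Complex.exp (-(Complex.I * a * y)) *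
      ((Complex.I * a * Complex.sin ((m - y) * x) - x * Complex.cos ((m - y) * x)) /
        (a ^ 2 - x ^ 2))) (Complex.exp (-(Complex.I * a * y)) * Complex.sin ((m - y) * x)) y := by
    intro y
    have e1 : HasDerivAt (fun z : ℂ => Complex.exp (-(Complex.I * a * z)))
        (Complex.exp (-(Complex.I * a * y)) * -(Complex.I * a * 1)) y :=
      ((hasDerivAt_id (y : ℂ)).const_mul (Complex.I * a)).neg.cexp
    have e2 : HasDerivAt (fun z : ℂ => (m - z) * x) (-1 * x) y :=
      ((hasDerivAt_id (y : ℂ)).const_sub (m : ℂ)).mul_const x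
    have e3 : HasDerivAt (fun z : ℂ => (Complex.I * a * Complex.sin ((m - z) * x) -
        x * Complex.cos ((m - z) * x)) / (a ^ 2 - x ^ 2)) ((Complex.I * a *
          (Complex.cos ((m - y) * x) * (-1 * x)) - x * (-Complex.sin ((m - y) * x) * (-1 * x))) /
          (a ^ 2 - x ^ 2)) y :=
      ((e2.csin.const_mul (Complex.I * a)).sub (e2.ccos.const_mul x)).div_const (a ^ 2 - x ^ 2)
    refine (e1.mul e3).comp_ofReal.congr_deriv ?_
    field_simp
    linear_combination -a ^ 2 * Complex.sin ((m - y) * x) * Complex.I_sq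
  rw [intervalIntegral.integral_eq_sub_of_hasDerivAt (fun y _ => hderiv y)
    (Continuous.intervalIntegrable (by fun_prop) _ _), he]
  have e4 : ((m : ℂ) - (2 * m : ℝ)) * x = -(m * x) := by push_cast; ring
  rw [e4, Complex.sin_neg, Complex.cos_neg]
  simp only [Complex.ofReal_zero, mul_zero, neg_zero, Complex.exp_zero, sub_zero]
  field_simp
  ring

/-- The constant cos(mx) is subtracted so that the function vanishes at both 0 and 2m. Its
antiperiodic extension is then continuous, and the coefficients decay like a⁻³ and are summable. -/
lemma integral_exp_mul_cos_sub {m : ℝ} {a x : ℂ} (ha0 : a ≠ 0) (ha : a ^ 2 - x ^ 2 ≠ 0)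
    (he : Complex.exp (-(Complex.I * a * (2 * m : ℝ))) = -1) :
    ∫ y in (0 : ℝ)..(2 * m), Complex.exp (-(Complex.I * a * y)) *
        (Complex.cos ((m - y) * x) - Complex.cos (m * x)) =
      -(2 * Complex.I * x ^ 2 * Complex.cos (m * x) / (a * (a ^ 2 - x ^ 2))) := by
  have hderiv : ∀ y : ℝ, HasDerivAt (fun y : ℝ => Complex.exp (-(Complex.I * a * y)) *
      ((Complex.I * a * Complex.cos ((m - y) * x) + x * Complex.sin ((m - y) * x)) /
        (a ^ 2 - x ^ 2) - Complex.I / a * Complex.cos (m * x)))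
      (Complex.exp (-(Complex.I * a * y)) *
        (Complex.cos ((m - y) * x) - Complex.cos (m * x))) y := by
    intro y
    have e1 : HasDerivAt (fun z : ℂ => Complex.exp (-(Complex.I * a * z)))
        (Complex.exp (-(Complex.I * a * y)) * -(Complex.I * a * 1)) y :=
      ((hasDerivAt_id (y : ℂ)).const_mul (Complex.I * a)).neg.cexp
    have e2 : HasDerivAt (fun z : ℂ => (m - z) * x) (-1 * x) y :=
      ((hasDerivAt_id (y : ℂ)).const_sub (m : ℂ)).mul_const x
    have e3 : HasDerivAt (fun z : ℂ => (Complex.I * a * Complex.cos ((m - z) * x) +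
        x * Complex.sin ((m - z) * x)) / (a ^ 2 - x ^ 2) - Complex.I / a * Complex.cos (m * x))
        ((Complex.I * a * (-Complex.sin ((m - y) * x) * (-1 * x)) +
          x * (Complex.cos ((m - y) * x) * (-1 * x))) / (a ^ 2 - x ^ 2)) y :=
      (((e2.ccos.const_mul (Complex.I * a)).add (e2.csin.const_mul x)).div_const
        (a ^ 2 - x ^ 2)).sub_const (Complex.I / a * Complex.cos (m * x))
    refine (e1.mul e3).comp_ofReal.congr_deriv ?_
    field_simp
    linear_combination (-a ^ 2 * Complex.cos ((m - y) * x) +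
      (a ^ 2 - x ^ 2) * Complex.cos (m * x)) * Complex.I_sq
  rw [intervalIntegral.integral_eq_sub_of_hasDerivAt (fun y _ => hderiv y)
    (Continuous.intervalIntegrable (by fun_prop) _ _), he]
  have e4 : ((m : ℂ) - (2 * m : ℝ)) * x = -(m * x) := by push_cast; ring
  rw [e4, Complex.sin_neg, Complex.cos_neg]
  simp only [Complex.ofReal_zero, mul_zero, neg_zero, Complex.exp_zero, sub_zero]
  field_simp
  ring

lemma exp_neg_I_mul_odd_mul {m : ℝ} (hm : 0 < m) (n : ℤ) :
    Complex.exp (-(Complex.I * ((2 * n + 1) * Real.pi / (2 * m : ℝ)) * (2 * m : ℝ))) = -1 := by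
  have hm' : (m : ℂ) ≠ 0 := by exact_mod_cast hm.ne'
  have : -(Complex.I * ((2 * n + 1) * Real.pi / (2 * m : ℝ)) * (2 * m : ℝ)) =
      -(Real.pi * Complex.I) + (-n : ℤ) * (2 * Real.pi * Complex.I) := by
    push_cast
    field_simp
    ring
  rw [this, Complex.exp_add, Complex.exp_int_mul_two_pi_mul_I, Complex.exp_neg,
    Complex.exp_pi_mul_I]
  norm_num

lemma odd_freq_natCast (m : ℝ) (n : ℕ) : ((2 * (n : ℤ) + 1) * Real.pi / (2 * m : ℝ) : ℂ) =
    (((2 * n + 1) * (Real.pi / (2 * m)) : ℝ) : ℂ) := by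
  push_cast
  ring

lemma odd_freq_neg (m : ℝ) (n : ℕ) :
    ((2 * ((-(n + 1) : ℤ) : ℂ) + 1) * Real.pi / (2 * m : ℝ) : ℂ) =
    -(((2 * n + 1) * (Real.pi / (2 * m)) : ℝ) : ℂ) := by
  push_cast
  ring

lemma sq_odd_freq_sub_ne_zero {m : ℝ} (hm : 0 < m) {x : ℂ} (hx : ‖x‖ < Real.pi / (2 * m)) (n : ℤ) :
    ((2 * n + 1) * Real.pi / (2 * m : ℝ) : ℂ) ^ 2 - x ^ 2 ≠ 0 := by
  have hr : 0 < Real.pi / (2 * m) := by positivity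
  obtain ⟨k, rfl | rfl⟩ : ∃ k : ℕ, n = k ∨ n = -(k + 1) := by
    cases n with
    | ofNat k => exact ⟨k, Or.inl rfl⟩
    | negSucc k => exact ⟨k, Or.inr (Int.negSucc_eq k)⟩
  · rw [odd_freq_natCast]
    exact sq_sub_sq_ne_zero hr hx k
  · rw [odd_freq_neg, neg_sq]
    exact sq_sub_sq_ne_zero hr hx k

lemma hasSum_of_eq {f g : ℕ → ℂ} {s : ℂ} (h : HasSum f s) (e : ∀ n, g n = f n) : HasSum g s := by
  rwa [show g = f from funext e]

/-- Partial fraction expansion of `sin ((m - y) x) / cos (m x)`. -/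
lemma hasSum_cos_div_sq_sub {m : ℝ} (hm : 0 < m) {x : ℂ} (hx : ‖x‖ < Real.pi / (2 * m)) {y : ℝ}
    (hy : y ∈ Set.Ico 0 (2 * m)) :
    HasSum (fun j : ℕ => x * (Real.cos (y * ((2 * j + 1) * (Real.pi / (2 * m)))) : ℂ) /
      ((((2 * j + 1) * (Real.pi / (2 * m)) : ℝ) : ℂ) ^ 2 - x ^ 2))
      (m / 2 * (Complex.sin ((m - y) * x) / Complex.cos (m * x))) := by
  have hr : 0 < Real.pi / (2 * m) := by positivity
  have hmC : (m : ℂ) ≠ 0 := by exact_mod_cast hm.ne'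
  have hc := cos_ne_zero_of_norm_lt hm hx
  have key := hasSum_fourier_antiperiodic (T := 2 * m) (by positivity)
    (F := fun y => Complex.sin ((m - y) * x)) (by fun_prop)
    (by rw [← Complex.sin_neg]; congr 1; push_cast; ring)
    (fun n => 1 / (2 * m : ℝ) * (2 * x * Complex.cos (m * x) /
      (((2 * n + 1) * Real.pi / (2 * m : ℝ)) ^ 2 - x ^ 2)))
    (fun n => by
      rw [integral_exp_mul_sin (sq_odd_freq_sub_ne_zero hm hx n) (exp_neg_I_mul_odd_mul hm n)]
      push_cast
      field_simp)
    (by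
      refine summable_int_odd (D := fun j => (1 / (2 * m : ℝ) * (2 * x * Complex.cos (m * x))) /
        ((((2 * j + 1) * (Real.pi / (2 * m)) : ℝ) : ℂ) ^ 2 - x ^ 2)) (fun n => ?_)
        (fun n => Or.inl ?_) (summable_div_sq_sub_sq hr hx fun _ => le_rfl)
      · rw [odd_freq_natCast, ← mul_div_assoc]
      · rw [odd_freq_neg, neg_sq, ← mul_div_assoc]) hy
  -- The integers n and -(n+1) carry opposite odd frequencies; pairing them turns the exponentials
  -- into cosines.
  have h := (key.nat_add_neg_add_one).mul_left (m / 2 * (Complex.cos (m * x))⁻¹)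
  have e : m / 2 * (Complex.sin ((m - y) * x) / Complex.cos (m * x)) =
      m / 2 * (Complex.cos (m * x))⁻¹ * Complex.sin ((m - y) * x) := by ring
  rw [e]
  refine hasSum_of_eq h fun j => ?_
  rw [odd_freq_natCast, odd_freq_neg, neg_sq]
  have hne := sq_sub_sq_ne_zero hr hx j
  rw [Complex.ofReal_cos, Complex.ofReal_mul y]
  set a : ℂ := (((2 * j + 1) * (Real.pi / (2 * m)) : ℝ) : ℂ)
  rw [Complex.cos, show (y : ℂ) * a * Complex.I = Complex.I * a * y by ring,
    show -((y : ℂ) * a) * Complex.I = Complex.I * -a * y by ring]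
  generalize Complex.cos (m * x) = c at hc ⊢
  push_cast
  field_simp

/-- Partial fraction expansion of `cos ((m - y) x) / cos (m x) - 1`. -/
lemma hasSum_sin_div_sq_sub {m : ℝ} (hm : 0 < m) {x : ℂ} (hx : ‖x‖ < Real.pi / (2 * m)) {y : ℝ}
    (hy : y ∈ Set.Ico 0 (2 * m)) :
    HasSum (fun j : ℕ => x ^ 2 * ((Real.sin (y * ((2 * j + 1) * (Real.pi / (2 * m)))) : ℂ) /
      (((2 * j + 1) * (Real.pi / (2 * m)) : ℝ) : ℂ)) /
      ((((2 * j + 1) * (Real.pi / (2 * m)) : ℝ) : ℂ) ^ 2 - x ^ 2))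
      (m / 2 * (Complex.cos ((m - y) * x) / Complex.cos (m * x) - 1)) := by
  have hr : 0 < Real.pi / (2 * m) := by positivity
  have hmC : (m : ℂ) ≠ 0 := by exact_mod_cast hm.ne'
  have hpi : (Real.pi : ℂ) ≠ 0 := by exact_mod_cast Real.pi_ne_zero
  have hc := cos_ne_zero_of_norm_lt hm hx
  have hodd : ∀ n : ℤ, ((2 * n + 1) * Real.pi / (2 * m : ℝ) : ℂ) ≠ 0 := by
    intro n
    have : (2 * n + 1 : ℂ) ≠ 0 := by
      have h : (2 * n + 1 : ℤ) ≠ 0 := by omega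
      exact_mod_cast h
    push_cast
    exact div_ne_zero (mul_ne_zero this hpi) (mul_ne_zero two_ne_zero hmC)
  have hra : ∀ j : ℕ, Real.pi / (2 * m) ≤ (2 * j + 1) * (Real.pi / (2 * m)) := fun j => by
    have : (0 : ℝ) ≤ j := Nat.cast_nonneg j
    nlinarith
  have key := hasSum_fourier_antiperiodic (T := 2 * m) (by positivity)
    (F := fun y => Complex.cos ((m - y) * x) - Complex.cos (m * x)) (by fun_prop)
    (by
      rw [show ((m : ℂ) - (2 * m : ℝ)) * x = -(m * x) by push_cast; ring, Complex.cos_neg]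
      simp)
    (fun n => 1 / (2 * m : ℝ) * -(2 * Complex.I * x ^ 2 * Complex.cos (m * x) /
      (((2 * n + 1) * Real.pi / (2 * m : ℝ)) *
        (((2 * n + 1) * Real.pi / (2 * m : ℝ)) ^ 2 - x ^ 2))))
    (fun n => by
      rw [integral_exp_mul_cos_sub (hodd n) (sq_odd_freq_sub_ne_zero hm hx n)
        (exp_neg_I_mul_odd_mul hm n), ← mul_assoc]
      have : ((2 * m : ℝ) : ℂ) ≠ 0 := by push_cast; exact mul_ne_zero two_ne_zero hmC
      rw [mul_one_div_cancel this, one_mul])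
    (by
      refine summable_int_odd (D := fun j =>
        ((1 / (2 * m : ℝ) * -(2 * Complex.I * x ^ 2 * Complex.cos (m * x))) /
          (((2 * j + 1) * (Real.pi / (2 * m)) : ℝ) : ℂ)) /
        ((((2 * j + 1) * (Real.pi / (2 * m)) : ℝ) : ℂ) ^ 2 - x ^ 2)) (fun n => ?_)
        (fun n => Or.inr ?_) (summable_div_sq_sub_sq (B := ‖1 / ((2 * m : ℝ) : ℂ) *
          -(2 * Complex.I * x ^ 2 * Complex.cos (m * x))‖ / (Real.pi / (2 * m))) hr hx fun j => ?_)
      · rw [odd_freq_natCast, div_div]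
        ring
      · rw [odd_freq_neg, neg_sq, div_div, neg_mul, div_neg]
        ring
      · rw [norm_div, Complex.norm_real, Real.norm_eq_abs, abs_of_pos (hr.trans_le (hra j))]
        exact div_le_div_of_nonneg_left (norm_nonneg _) hr (hra j)) hy
  have h := (key.nat_add_neg_add_one).mul_left (m / 2 * (Complex.cos (m * x))⁻¹)
  have e : m / 2 * (Complex.cos ((m - y) * x) / Complex.cos (m * x) - 1) =
      m / 2 * (Complex.cos (m * x))⁻¹ * (Complex.cos ((m - y) * x) - Complex.cos (m * x)) := by
    field_simp
  rw [e]
  refine hasSum_of_eq h fun j => ?_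
  rw [odd_freq_natCast, odd_freq_neg, neg_sq]
  have hne := sq_sub_sq_ne_zero hr hx j
  have ha0 : (((2 * j + 1) * (Real.pi / (2 * m)) : ℝ) : ℂ) ≠ 0 := by
    exact_mod_cast (hr.trans_le (hra j)).ne'
  rw [Complex.ofReal_sin, Complex.ofReal_mul y]
  set a : ℂ := (((2 * j + 1) * (Real.pi / (2 * m)) : ℝ) : ℂ)
  rw [Complex.sin, show (y : ℂ) * a * Complex.I = Complex.I * a * y by ring,
    show -((y : ℂ) * a) * Complex.I = Complex.I * -a * y by ring]
  generalize Complex.cos (m * x) = c at hc ⊢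
  push_cast
  field_simp
  ring

/-! ### Convergence of the Dirichlet series and summation of the generating function. -/

lemma abs_jacobiSym_le_one (a : ℤ) (b : ℕ) : |(J(a | b) : ℝ)| ≤ 1 := by
  rcases jacobiSym.trichotomy a b with h | h | h <;> rw [h] <;> simp

lemma tendsto_dirichletPartialSum (m : ℤ) {s : ℕ} (hs : 2 ≤ s) :
    Tendsto (dirichletPartialSum m s) atTop
      (𝓝 (∑' j : ℕ, (J(-m | 2 * j + 1) : ℝ) / ((2 * j + 1 : ℕ) : ℝ) ^ s)) := by
  refine (Summable.of_norm_bounded (g := fun j : ℕ => 1 / ((2 * j + 1 : ℕ) : ℝ) ^ s) ?_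
    fun j => ?_).hasSum.tendsto_sum_nat
  · exact ((Real.summable_one_div_nat_pow (p := s)).2 (by omega)).comp_injective
      (i := fun j : ℕ => 2 * j + 1) fun a b hab => by simpa using hab
  · rw [norm_div, norm_pow, Real.norm_natCast, Real.norm_eq_abs]
    gcongr
    exact abs_jacobiSym_le_one _ _

/-- The finite sine expansion writes the partial sums as a finite combination of square wave partial
sums at y = kπ/(2m), each converging to π/4. -/
lemma tendsto_dirichletPartialSum_one {m q : ℕ} (hm : m = 2 * q) (hq : Odd q)
    (hsq : Squarefree q) :
    Tendsto (dirichletPartialSum (m : ℤ) 1) atTop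
      (𝓝 (2 / √(m : ℝ) * ∑ k ∈ (Finset.Icc 1 (m - 1)).filter (fun k => Odd k),
        (kronecker q k : ℝ) * (Real.pi / 4))) := by
  have hm0 : (0 : ℝ) < m := by rw [hm]; have := hq.pos; positivity
  have h : Tendsto (fun N => 2 / √(m : ℝ) *
      ∑ k ∈ (Finset.Icc 1 (m - 1)).filter (fun k => Odd k), (kronecker q k : ℝ) *
        ∑ j ∈ Finset.range N,
          Real.sin ((2 * j + 1) * (k * (Real.pi / (2 * m)))) / (2 * j + 1)) atTop
      (𝓝 (2 / √(m : ℝ) * ∑ k ∈ (Finset.Icc 1 (m - 1)).filter (fun k => Odd k),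
        (kronecker q k : ℝ) * (Real.pi / 4))) := by
    refine Tendsto.const_mul _ (tendsto_finsetSum _ fun k hk => Tendsto.const_mul _ ?_)
    simp only [Finset.mem_filter, Finset.mem_Icc] at hk
    have hk0 : (0 : ℝ) < k := by exact_mod_cast hk.1.1
    have hkm : (k : ℝ) ≤ m := by exact_mod_cast (by omega : k ≤ m)
    refine tendsto_sum_sin_odd (by have := Real.pi_pos; positivity) ?_
    calc k * (Real.pi / (2 * m)) ≤ m * (Real.pi / (2 * m)) := by
          have := Real.pi_pos; gcongr
      _ = Real.pi / 2 := by field_simp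
  refine h.congr fun N => ?_
  simp only [Finset.mul_sum, dirichletPartialSum]
  rw [Finset.sum_comm]
  refine Finset.sum_congr rfl fun j _ => ?_
  rw [hm, jacobiSym_eq_kronecker hq ⟨j, rfl⟩, kronecker_eq_sum_sin hm hq hsq ⟨j, rfl⟩, ← hm,
    pow_one, Finset.mul_sum, Finset.sum_div]
  refine Finset.sum_congr rfl fun k _ => ?_
  push_cast
  rw [show (2 * (j : ℝ) + 1) * (k * (Real.pi / (2 * m))) =
    k * ((2 * j + 1) * (Real.pi / (2 * m))) by ring]
  ring

lemma tsum_div_freq_pow (r : ℝ) (χ : ℕ → ℤ) (p : ℕ) :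
    ∑' j : ℕ, (χ j : ℂ) / (((2 * j + 1) * r : ℝ) : ℂ) ^ p =
      ((∑' j : ℕ, (χ j : ℝ) / ((2 * j + 1 : ℕ) : ℝ) ^ p : ℝ) : ℂ) * ((r : ℂ) ^ p)⁻¹ := by
  rw [Complex.ofReal_tsum, ← tsum_mul_right]
  refine tsum_congr fun j => ?_
  push_cast
  rw [mul_pow, ← div_div, div_eq_mul_inv _ ((r : ℂ) ^ p)]

/-- The even part of the generating function. -/
lemma hasSum_sTerm_even {m q : ℕ} (hm : m = 2 * q) (hq : Odd q) (hsq : Squarefree q) {x : ℂ}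
    (hx : ‖x‖ < Real.pi / (2 * m)) :
    HasSum (fun n => sTerm m x (2 * n))
      (∑ k ∈ (Finset.Icc 1 (m - 1)).filter (fun k => Odd k), (kronecker q k : ℂ) *
        (Complex.cos (((m : ℂ) - k) * x) / Complex.cos (m * x))) := by
  have hm0 : (0 : ℝ) < m := by rw [hm]; have := hq.pos; positivity
  have hmC : (m : ℂ) ≠ 0 := by exact_mod_cast hm0.ne'
  have hs0 : 0 < √(m : ℝ) := Real.sqrt_pos.2 hm0
  have hsC : ((√(m : ℝ) : ℝ) : ℂ) ≠ 0 := by exact_mod_cast hs0.ne'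
  have hss : ((√(m : ℝ) : ℝ) : ℂ) ^ 2 = m := by
    rw [← Complex.ofReal_pow, Real.sq_sqrt hm0.le]; norm_cast
  have hr : 0 < Real.pi / (2 * m) := by positivity
  have hK : K m = 1 := by rw [K, if_neg (by omega)]
  set S := (Finset.Icc 1 (m - 1)).filter (fun k => Odd k) with hS
  set r : ℝ := Real.pi / (2 * m) with hrdef
  let b : ℕ → ℂ := fun j => (kronecker q (2 * j + 1) : ℂ) / (((2 * j + 1) * r : ℝ) : ℂ)
  have hra : ∀ j : ℕ, r ≤ (2 * j + 1) * r := fun j => by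
    have : (0 : ℝ) ≤ j := Nat.cast_nonneg j
    nlinarith
  have hb : ∀ j, ‖b j‖ ≤ 1 / r := by
    intro j
    simp only [b]
    rw [norm_div, Complex.norm_real, Real.norm_eq_abs, abs_of_pos (hr.trans_le (hra j)),
      ← jacobiSym_eq_kronecker hq ⟨j, rfl⟩]
    have := abs_jacobiSym_le_one (-((2 * q : ℕ) : ℤ)) (2 * j + 1)
    have h2 : ‖((J(-((2 * q : ℕ) : ℤ) | 2 * j + 1) : ℤ) : ℂ)‖ ≤ 1 := by
      rw [Complex.norm_intCast]; exact this
    exact div_le_div₀ zero_le_one h2 hr (hra j)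
  have hpow := (hasSum_pow_of_partial_fractions hr hx hb).mul_left
    (((√(m : ℝ) : ℝ) : ℂ)⁻¹ * x ^ 2)
  have hfrac : HasSum (fun j : ℕ => b j / ((((2 * j + 1) * r : ℝ) : ℂ) ^ 2 - x ^ 2) * x ^ 2)
      (2 / (√(m : ℝ) : ℝ) * ∑ k ∈ S, (kronecker q k : ℂ) *
        (m / 2 * (Complex.cos (((m : ℂ) - k) * x) / Complex.cos (m * x) - 1))) := by
    have h := (hasSum_sum fun k (hk : k ∈ S) => (hasSum_sin_div_sq_sub hm0 (x := x) hx (y := k)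
      ⟨Nat.cast_nonneg k, by
        simp only [hS, Finset.mem_filter, Finset.mem_Icc] at hk
        exact_mod_cast (by omega : k < 2 * m)⟩).mul_left (kronecker q k : ℂ)).mul_left
      (2 / (√(m : ℝ) : ℝ) : ℂ)
    refine hasSum_of_eq h fun j => ?_
    have hk := congrArg Complex.ofReal (kronecker_eq_sum_sin hm hq hsq (l := 2 * j + 1) ⟨j, rfl⟩)
    rw [Complex.ofReal_intCast] at hk
    simp only [b]
    rw [hk]
    push_cast
    simp only [← hS, Finset.mul_sum, Finset.sum_div, Finset.sum_mul]
    refine Finset.sum_congr rfl fun k _ => ?_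
    simp only [hrdef]
    push_cast
    ring
  -- Only the terms of positive index come from the absolutely convergent double series, which
  -- accounts for the -1 in each summand.
  have hfrac' : HasSum (fun n => sTerm m x (2 * (n + 1)))
      (∑ k ∈ S, (kronecker q k : ℂ) *
        (Complex.cos (((m : ℂ) - k) * x) / Complex.cos (m * x) - 1)) := by
    have e : ∑ k ∈ S, (kronecker q k : ℂ) *
        (Complex.cos (((m : ℂ) - k) * x) / Complex.cos (m * x) - 1) =
        ((√(m : ℝ) : ℝ) : ℂ)⁻¹ * x ^ 2 *
          ∑' j : ℕ, b j / ((((2 * j + 1) * r : ℝ) : ℂ) ^ 2 - x ^ 2) := by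
      rw [mul_assoc, mul_comm (x ^ 2), ← tsum_mul_right, hfrac.tsum_eq, Finset.mul_sum,
        Finset.mul_sum]
      refine Finset.sum_congr rfl fun k _ => ?_
      field_simp
      rw [hss]
      ring
    rw [e]
    refine hasSum_of_eq hpow fun n => ?_
    have hL : dirichletL (m : ℤ) (2 * (n + 1) + 1) = ∑' j : ℕ,
        (kronecker q (2 * j + 1) : ℝ) / ((2 * j + 1 : ℕ) : ℝ) ^ (2 * (n + 1) + 1) := by
      rw [dirichletL, (tendsto_dirichletPartialSum (m : ℤ) (by omega)).limUnder_eq]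
      refine tsum_congr fun j => ?_
      rw [← jacobiSym_eq_kronecker hq ⟨j, rfl⟩, hm]
    have hsum : ∑' j : ℕ, b j / (((2 * j + 1) * r : ℝ) : ℂ) ^ (2 * n + 2) =
        (dirichletL (m : ℤ) (2 * (n + 1) + 1) : ℂ) * ((r : ℂ) ^ (2 * (n + 1) + 1))⁻¹ := by
      rw [hL, ← tsum_div_freq_pow r (fun j => kronecker q (2 * j + 1))]
      refine tsum_congr fun j => ?_
      simp only [b]
      rw [div_div, ← pow_succ']
      rfl
    have hz : (r : ℝ) ^ (-2 * ((n + 1 : ℕ) : ℤ) - 1) = (r ^ (2 * (n + 1) + 1))⁻¹ := by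
      rw [← zpow_natCast, ← zpow_neg]
      congr 1
    rw [hsum, sTerm, s, if_pos (even_two_mul _), Nat.mul_div_cancel_left _ two_pos, c, hK, one_mul,
      ← hrdef, hz]
    have hfac : (((2 * (n + 1))! : ℕ) : ℂ) ≠ 0 := by exact_mod_cast Nat.factorial_ne_zero _
    push_cast
    generalize (((2 * (n + 1))! : ℕ) : ℂ) = F at hfac ⊢
    field_simp
    ring
  -- The term of index 0 is L_m(1) normalized; its value ∑ K(k) restores what the -1 removed.
  have hzero : sTerm m x (2 * 0) = ∑ k ∈ S, (kronecker q k : ℂ) := by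
    have hL : dirichletL (m : ℤ) 1 = _ :=
      (tendsto_dirichletPartialSum_one hm hq hsq).limUnder_eq
    rw [← hS, ← Finset.sum_mul] at hL
    have hpi := Real.pi_ne_zero
    have hc0 : c m 0 = ∑ k ∈ S, (kronecker q k : ℝ) := by
      rw [c, hK, one_mul, mul_zero, zero_add, hL, ← hrdef, Nat.cast_zero, mul_zero, zero_sub,
        zpow_neg_one, Nat.factorial_zero, hrdef]
      have h2 : √(m : ℝ) ^ 2 = m := Real.sq_sqrt hm0.le
      generalize ∑ k ∈ S, (kronecker q k : ℝ) = A
      push_cast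
      field_simp
      rw [h2]
      ring
    rw [sTerm, s, if_pos (even_two_mul 0), mul_zero, Nat.zero_div, hc0]
    push_cast
    simp
  have h := (hasSum_nat_add_iff (f := fun n => sTerm m x (2 * n)) 1).1 hfrac'
  rw [Finset.sum_range_one, hzero, ← Finset.sum_add_distrib] at h
  simpa only [mul_sub, mul_one, sub_add_cancel] using h

/-- The odd part of the generating function. -/
lemma hasSum_sTerm_odd {m q : ℕ} (hm : m = 2 * q) (hq : Odd q) (hsq : Squarefree q) {x : ℂ}
    (hx : ‖x‖ < Real.pi / (2 * m)) :
    HasSum (fun n => sTerm m x (2 * n + 1))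
      (∑ k ∈ (Finset.Icc 1 (m - 1)).filter (fun k => Odd k), (kronecker q k : ℂ) *
        (Complex.sin ((k : ℂ) * x) / Complex.cos (m * x))) := by
  have hm0 : (0 : ℝ) < m := by rw [hm]; have := hq.pos; positivity
  have hmC : (m : ℂ) ≠ 0 := by exact_mod_cast hm0.ne'
  have hs0 : 0 < √(m : ℝ) := Real.sqrt_pos.2 hm0
  have hsC : ((√(m : ℝ) : ℝ) : ℂ) ≠ 0 := by exact_mod_cast hs0.ne'
  have hss : ((√(m : ℝ) : ℝ) : ℂ) ^ 2 = m := by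
    rw [← Complex.ofReal_pow, Real.sq_sqrt hm0.le]; norm_cast
  have hr : 0 < Real.pi / (2 * m) := by positivity
  have hK : K m = 1 := by rw [K, if_neg (by omega)]
  set S := (Finset.Icc 1 (m - 1)).filter (fun k => Odd k) with hS
  set r : ℝ := Real.pi / (2 * m) with hrdef
  let b : ℕ → ℂ := fun j => (J((m : ℤ) | 2 * j + 1) : ℂ)
  have hb : ∀ j, ‖b j‖ ≤ 1 := fun j => by
    simp only [b, Complex.norm_intCast]
    exact abs_jacobiSym_le_one _ _
  have hpow := (hasSum_pow_of_partial_fractions hr hx hb).mul_left (((√(m : ℝ) : ℝ) : ℂ)⁻¹ * x)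
  have hfrac : HasSum (fun j : ℕ => b j / ((((2 * j + 1) * r : ℝ) : ℂ) ^ 2 - x ^ 2) * x)
      (2 / (√(m : ℝ) : ℝ) * ∑ k ∈ S, (kronecker q k : ℂ) *
        (m / 2 * (Complex.sin ((k : ℂ) * x) / Complex.cos (m * x)))) := by
    -- The choice y = m - k makes (m - y)x = kx, so the cosine expansion of (m/l) is matched with
    -- sin(kx)/cos(mx).
    have h := (hasSum_sum fun k (hk : k ∈ S) => (hasSum_cos_div_sq_sub hm0 (x := x) hx (y := m - k)
      ⟨by
        simp only [hS, Finset.mem_filter, Finset.mem_Icc] at hk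
        have : (k : ℝ) ≤ m := by exact_mod_cast (by omega : k ≤ m)
        linarith, by
        have : (0 : ℝ) ≤ k := Nat.cast_nonneg k
        linarith⟩).mul_left (kronecker q k : ℂ)).mul_left
      (2 / (√(m : ℝ) : ℝ) : ℂ)
    have e : ∀ k : ℕ, ((((m : ℝ) : ℂ) - ((m : ℝ) - (k : ℝ) : ℝ)) * x) = k * x := by
      intro k
      push_cast
      ring
    simp only [e] at h
    refine hasSum_of_eq h fun j => ?_
    have hk := congrArg Complex.ofReal (jacobiSym_eq_sum_cos hm hq hsq (l := 2 * j + 1) ⟨j, rfl⟩)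
    rw [Complex.ofReal_intCast] at hk
    simp only [b]
    rw [hk]
    push_cast
    simp only [← hS, Finset.mul_sum, Finset.sum_div, Finset.sum_mul]
    refine Finset.sum_congr rfl fun k _ => ?_
    simp only [hrdef]
    push_cast
    ring
  have e : ∑ k ∈ S, (kronecker q k : ℂ) * (Complex.sin ((k : ℂ) * x) / Complex.cos (m * x)) =
      ((√(m : ℝ) : ℝ) : ℂ)⁻¹ * x *
        ∑' j : ℕ, b j / ((((2 * j + 1) * r : ℝ) : ℂ) ^ 2 - x ^ 2) := by
    rw [mul_assoc, mul_comm x, ← tsum_mul_right, hfrac.tsum_eq, Finset.mul_sum, Finset.mul_sum]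
    refine Finset.sum_congr rfl fun k _ => ?_
    field_simp
    rw [hss]
  rw [e]
  refine hasSum_of_eq hpow fun n => ?_
  have hL : dirichletL (-(m : ℤ)) (2 * (n + 1)) = ∑' j : ℕ,
      (J((m : ℤ) | 2 * j + 1) : ℝ) / ((2 * j + 1 : ℕ) : ℝ) ^ (2 * (n + 1)) := by
    rw [dirichletL, (tendsto_dirichletPartialSum (-(m : ℤ)) (by omega)).limUnder_eq, neg_neg]
  have hsum : ∑' j : ℕ, b j / (((2 * j + 1) * r : ℝ) : ℂ) ^ (2 * n + 2) =
      (dirichletL (-(m : ℤ)) (2 * (n + 1)) : ℂ) * ((r : ℂ) ^ (2 * (n + 1)))⁻¹ := by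
    rw [hL, ← tsum_div_freq_pow r (fun j => J((m : ℤ) | 2 * j + 1))]
    rfl
  have hz : (r : ℝ) ^ (-2 * ((n + 1 : ℕ) : ℤ)) = (r ^ (2 * (n + 1)))⁻¹ := by
    rw [← zpow_natCast, ← zpow_neg]
    congr 1
  rw [hsum, sTerm, s, if_neg (by simp), show (2 * n + 1 + 1) / 2 = n + 1 by omega, d, hK, one_mul,
    ← hrdef, hz, show 2 * (n + 1) - 1 = 2 * n + 1 by omega]
  have hfac : (((2 * n + 1)! : ℕ) : ℂ) ≠ 0 := by exact_mod_cast Nat.factorial_ne_zero _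
  push_cast
  generalize (((2 * n + 1)! : ℕ) : ℂ) = F at hfac ⊢
  field_simp
  ring

end ShanksNumbers

theorem theorem2p3 (m t : ℕ) (hm : m = 4 * t + 2) (hsq : Squarefree m) :
    -- the Dirichlet series in the definition of the numbers `s_{m,n}` converge
    (∀ n : ℕ, Tendsto (ShanksNumbers.dirichletPartialSum (m : ℤ) (2 * n + 1)) atTop
      (𝓝 (ShanksNumbers.dirichletL (m : ℤ) (2 * n + 1)))) ∧
    (∀ n : ℕ, 1 ≤ n → Tendsto (ShanksNumbers.dirichletPartialSum (-(m : ℤ)) (2 * n)) atTop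
      (𝓝 (ShanksNumbers.dirichletL (-(m : ℤ)) (2 * n)))) ∧
    -- the generating function converges for `|x| < π / (2m)`, with the asserted sum
    ∀ x : ℂ, ‖x‖ < Real.pi / (2 * m) →
      Summable (ShanksNumbers.sTerm m x) ∧
      ShanksNumbers.sGen m x =
        ∑ k ∈ (Finset.Icc 1 (4 * t + 1)).filter (fun k => Odd k),
          (J(-(m : ℤ) | k) : ℂ) * ShanksNumbers.Lam m k x := by
  have hmq : m = 2 * (2 * t + 1) := by omega
  have hq : Odd (2 * t + 1) := ⟨t, rfl⟩
  have hsq' : Squarefree (2 * t + 1) := hsq.squarefree_of_dvd ⟨2, by omega⟩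
  refine ⟨fun n => ?_, fun n hn => ?_, fun x hx => ?_⟩
  -- The exponent 1 is the conditionally convergent case; every other exponent is at least 2.
  · rcases n with _ | n
    · exact tendsto_nhds_limUnder ⟨_, ShanksNumbers.tendsto_dirichletPartialSum_one hmq hq hsq'⟩
    · exact tendsto_nhds_limUnder ⟨_, ShanksNumbers.tendsto_dirichletPartialSum _ (by omega)⟩
  · exact tendsto_nhds_limUnder ⟨_, ShanksNumbers.tendsto_dirichletPartialSum _ (by omega)⟩
  · have h := (ShanksNumbers.hasSum_sTerm_even hmq hq hsq' hx).even_add_odd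
      (ShanksNumbers.hasSum_sTerm_odd hmq hq hsq' hx)
    refine ⟨h.summable, ?_⟩
    rw [ShanksNumbers.sGen, h.tsum_eq, ← Finset.sum_add_distrib,
      show m - 1 = 4 * t + 1 by omega]
    refine Finset.sum_congr rfl fun k hk => ?_
    rw [hmq, ShanksNumbers.jacobiSym_eq_kronecker hq (Finset.mem_filter.1 hk).2, ShanksNumbers.Lam]
    ring
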